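/- Let $f(z)=\sum_{i\ge 0}\hat f(i)z^i$ be a power series with real coefficients and radius of convergence $R>0$, with $f(0)=1$ and $f'(0)=0$. Put $L=\{i>0:\hat f(i)\neq 0\}$ and assume $\gcd L=1$ (in particular $f$ is not constant). Say that $f$ is strongly positive at $r\in(0,R)$ if $|f(re^{i\theta})|<f(r)$ for $0<\theta<2\pi$, and assume that $f$ is strongly positive at all sufficiently small $r>0$. Define $\mu_f(r)=rf'(r)/f(r)$ and $\sigma_f(r)=r\mu_f'(r)$, and define $\phi(r,z)$ for $r>0$ and $\operatorname{Re} f(re^z)>0$ by $\phi(r,0)=1$ and $$\frac{f(re^z)}{f(r)}=\exp\Bigl(\mu_f(r)z+\tfrac12\sigma_f(r)z^2\phi(r,z)\Bigr)$$ (principal logarithm). Let $l=\min L$ (so $l\ge 2$), and for $1\le j\le\lfloor l/2\rfloor$ let $l_j=\min\{i\in L: ji\not\equiv 0 \pmod l\}$. Let $$\epsilon_0=\max_{1\le j\le\lfloor l/2\rfloor}\Bigl(1-\frac{l}{l_j}\Bigr)\quad\text{and}\quad \epsilon_0<\delta<1.$$ Let $k=k(n)$ be non-negative integers with $k\approx n^\delta$,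 i.e. $k=O(n^\delta)$ and $n^\delta=O(k)$ as $n\to\infty$. Then for all large $n$ there is a unique $r=r(n)>0$ such that $f$ is strongly positive at every point of $(0,r]$ and $k=n\mu_f(r)$. With this $r$, $\mu=\mu_f(r)$ and $\sigma=\sigma_f(r)$, the coefficient $[z^k]f^n$ has, as $n\to\infty$, the full asymptotic expansion $$[z^k]f^n\sim\frac{f(r)^n}{r^k\sqrt{2\pi n\sigma}}\Bigl(1+\sum_{\nu=1}^\infty\frac{c_\nu}{k^\nu}\Bigr),\qquad c_\nu=\frac{(-1)^\nu\mu^\nu}{(2\sigma)^\nu\,\nu!}\left[\frac{\partial^{2\nu}}{\partial z^{2\nu}}\,\phi(r,z)^{-\nu-1/2}\right]_{z=0},$$ where $c_\nu=c_\nu(r)$ depends on $n$ through $r$; that is, for every $N\ge 0$, $$[z^k]f^n=\frac{f(r)^n}{r^k\sqrt{2\pi n\sigma}}\Bigl(1+\sum_{\nu=1}^N\frac{c_\nu}{k^\nu}+O\bigl(k^{-N-1}\bigr)\Bigr)\quad\text{as } n\to\infty.$$ -/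

import Mathlib

open Filter Topology Asymptotics

noncomputable section

namespace LargePowers

/-- The radius of convergence of a formal power series with real coefficients. -/
def radius (F : PowerSeries ℝ) : ENNReal :=
  (FormalMultilinearSeries.ofScalars ℝ (fun i => PowerSeries.coeff i F)).radius

/-- The sum `f(z)` of the series at a complex number `z` (meant for `|z| < radius F`). -/
def evalC (F : PowerSeries ℝ) (z : ℂ) : ℂ :=
  ∑' i : ℕ, ((PowerSeries.coeff i F : ℝ) : ℂ) * z ^ i

/-- The sum `f(x)` of the series at a real number `x` (meant for `|x| < radius F`). -/
def evalR (F : PowerSeries ℝ) (x : ℝ) : ℝ :=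
  ∑' i : ℕ, PowerSeries.coeff i F * x ^ i

/-- `f` is strongly positive at `r`: `r` is a positive number inside the disc of convergence and
`|f(r e^{iθ})| < f(r)` for `0 < θ < 2π`. -/
def StronglyPositiveAt (F : PowerSeries ℝ) (r : ℝ) : Prop :=
  0 < r ∧ ENNReal.ofReal r < radius F ∧
    ∀ θ : ℝ, 0 < θ → θ < 2 * Real.pi →
      ‖evalC F ((r : ℂ) * Complex.exp (Complex.I * (θ : ℂ)))‖ < evalR F r

/-- `μ_f(r) = r f'(r) / f(r)`. -/
def mu (F : PowerSeries ℝ) (r : ℝ) : ℝ :=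
  r * deriv (evalR F) r / evalR F r

/-- `σ_f(r) = r μ_f'(r)`. -/
def sigma (F : PowerSeries ℝ) (r : ℝ) : ℝ :=
  r * deriv (mu F) r

/-- `L(f)`, the set of positive exponents with a non-zero coefficient. -/
def expSet (F : PowerSeries ℝ) : Set ℕ :=
  {i | 0 < i ∧ PowerSeries.coeff i F ≠ 0}

/-- `l(f) = min L(f)`. -/
def minExp (F : PowerSeries ℝ) : ℕ :=
  sInf (expSet F)

/-- `l_j = min {i ∈ L(f) : j i ≢ 0 (mod l)}`. -/
def lExp (F : PowerSeries ℝ) (j : ℕ) : ℕ :=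
  sInf {i | i ∈ expSet F ∧ ¬ minExp F ∣ j * i}

/-- `ε₀ = max {1 - l / l_j : 1 ≤ j ≤ ⌊l/2⌋}`. -/
def eps0 (F : PowerSeries ℝ) : ℝ :=
  sSup ((fun j : ℕ => 1 - (minExp F : ℝ) / (lExp F j : ℝ)) '' Set.Icc 1 (minExp F / 2))

/-- The function `φ(r, z)`, for `r > 0`: `φ(r, 0) = 1` and
`f(r e^z) / f(r) = exp (μ_f(r) z + (1/2) σ_f(r) z² φ(r, z))`, with the principal logarithm, which is
holomorphic on the region `Re f(r e^z) > 0` where `φ` is considered. -/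
def phi (F : PowerSeries ℝ) (r : ℝ) (z : ℂ) : ℂ :=
  if z = 0 then 1
  else
    (Complex.log (evalC F ((r : ℂ) * Complex.exp z) / (evalR F r : ℂ)) - (mu F r : ℂ) * z) /
      ((1 / 2 : ℂ) * (sigma F r : ℂ) * z ^ 2)

/-- The coefficient
`c_ν(r) = (-1)^ν μ^ν / ((2σ)^ν ν!) · [∂^{2ν}/∂z^{2ν} φ(r, z)^{-ν-1/2}]_{z=0}`. -/
def expansionCoeff (F : PowerSeries ℝ) (r : ℝ) (ν : ℕ) : ℂ :=
  ((-1 : ℂ) ^ ν * (mu F r : ℂ) ^ ν) / ((2 * (sigma F r : ℂ)) ^ ν * (ν.factorial : ℂ)) *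
    iteratedDeriv (2 * ν) (fun z : ℂ => phi F r z ^ (-(ν : ℂ) - 1 / 2)) 0

/-- The leading term `f(r)^n / (r^k √(2 π n σ_f(r)))`. -/
def mainTerm (F : PowerSeries ℝ) (n k : ℕ) (r : ℝ) : ℝ :=
  evalR F r ^ n / (r ^ k * Real.sqrt (2 * Real.pi * (n : ℝ) * sigma F r))

/-- `r` solves `k = n μ_f(r)` on the branch that starts at `0⁺`: `r > 0` and `f` is strongly
positive at every point of `(0, r]`. -/
def IsSaddle (F : PowerSeries ℝ) (n k : ℕ) (r : ℝ) : Prop :=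
  0 < r ∧ (∀ s : ℝ, 0 < s → s ≤ r → StronglyPositiveAt F s) ∧ (k : ℝ) = (n : ℝ) * mu F r

end LargePowers

end

noncomputable section

namespace LargePowers

/-! The proof is the saddle point method on the circle `|z| = r`, with `k = n μ(r)`. Since `μ(r)`
has order `r^l` and `k` has order `n^δ` with `δ < 1`, the radius tends to 0, so every estimate must
be uniform in small `r`.

Near `θ = 0` the saddle equation cancels the linear term of `n log f(re^{iθ}) - ikθ` and leaves
`exp(-nσθ²φ(r,iθ)/2)`. As `r → 0`, `log (f(re^z)/f(r))` is `a r^l (e^{lz} - 1)` up to `O(r^{l+1})`,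
where `a > 0` is the coefficient of `z^l`. After division by `σ`, also of order `r^l`, the function
`φ(r,·)` is holomorphic with real part at least 1/2 on a disc independent of `r`
(`local_expansion`). `laplace_expansion` then applies with a constant uniform over all such `φ`. Its
parameter `nσ` is comparable with `k = nμ`, so the error has order `k^{-N-1}`.

Away from `θ = 0`, put `ζ = e^{iθ}` and let `p` be the first exponent of `f` with `ζ^p ≠ 1`. Strong
positivity near 0 forces the coefficient of `z^p` to be positive, which yields `|f(re^{iθ})| ≤ f(r)
exp(-c r^p)` near that angle, and compactness makes the bound uniform (`norm_evalC_le_off_saddle`).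
The definition of `ε₀` gives `(1-δ)p < l`, so `n r^p` is at least a positive power of `n` and this
part of the circle is negligible against every power of `k`.

Existence and uniqueness of `r` follow from `σ > 0` near 0. Larger solutions are excluded because `t
↦ log f(e^t)` is convex along the strongly positive branch, by the three lines theorem, so that `μ`
is nondecreasing there. -/

/-! ### Power series in a disc and Cauchy's coefficient formula. -/

theorem summable_norm_coeff_mul_pow {F : PowerSeries ℝ} {x : ℝ} (hx : 0 ≤ x)
    (h : ENNReal.ofReal x < radius F) : Summable fun i => |PowerSeries.coeff i F| * x ^ i := by
  have := FormalMultilinearSeries.summable_norm_mul_pow _ (r := x.toNNReal) h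
  simpa [FormalMultilinearSeries.ofScalars_norm, Real.coe_toNNReal x hx] using this

theorem norm_coeff_mul_pow (F : PowerSeries ℝ) (w : ℂ) (i : ℕ) :
    ‖((PowerSeries.coeff i F : ℝ) : ℂ) * w ^ i‖ = |PowerSeries.coeff i F| * ‖w‖ ^ i := by
  simp

theorem summable_norm_evalC {F : PowerSeries ℝ} {x : ℝ}
    (h : Summable fun i => |PowerSeries.coeff i F| * x ^ i) {w : ℂ} (hw : ‖w‖ ≤ x) :
    Summable fun i => ‖((PowerSeries.coeff i F : ℝ) : ℂ) * w ^ i‖ := by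
  refine Summable.of_nonneg_of_le (fun i => norm_nonneg _) (fun i => ?_) h
  rw [norm_coeff_mul_pow]
  gcongr

theorem hasSum_evalC {F : PowerSeries ℝ} {x : ℝ}
    (h : Summable fun i => |PowerSeries.coeff i F| * x ^ i) {w : ℂ} (hw : ‖w‖ ≤ x) :
    HasSum (fun i => ((PowerSeries.coeff i F : ℝ) : ℂ) * w ^ i) (evalC F w) :=
  (summable_norm_evalC h hw).of_norm.hasSum

theorem evalC_ofReal (F : PowerSeries ℝ) (x : ℝ) : evalC F x = (evalR F x : ℂ) := by
  simp [evalC, evalR, Complex.ofReal_tsum]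

theorem differentiableOn_evalC {F : PowerSeries ℝ} {x : ℝ}
    (h : Summable fun i => |PowerSeries.coeff i F| * x ^ i) :
    DifferentiableOn ℂ (evalC F) (Metric.ball 0 x) := by
  refine Complex.differentiableOn_tsum_of_summable_norm h (fun i => by fun_prop)
    Metric.isOpen_ball (fun i w hw => ?_)
  rw [norm_coeff_mul_pow]
  have : ‖w‖ ≤ x := (mem_ball_zero_iff.1 hw).le
  gcongr

/-- For `i ≥ m` each term is at most `(‖w‖/x)^m` times its value at radius `x`, so one constant
serves the whole closed disc. -/
theorem norm_evalC_sub_sum_le {F : PowerSeries ℝ} {x : ℝ} (hx : 0 < x)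
    (h : Summable fun i => |PowerSeries.coeff i F| * x ^ i) (m : ℕ) :
    ∃ C : ℝ, 0 ≤ C ∧ ∀ w : ℂ, ‖w‖ ≤ x →
      ‖evalC F w - ∑ i ∈ Finset.range m, ((PowerSeries.coeff i F : ℝ) : ℂ) * w ^ i‖ ≤
        C * ‖w‖ ^ m := by
  have h2 := (summable_nat_add_iff m).2 h
  refine ⟨(∑' i, |PowerSeries.coeff (i + m) F| * x ^ (i + m)) / x ^ m, ?_, fun w hw => ?_⟩
  · exact div_nonneg (tsum_nonneg fun i => by positivity) (by positivity)
  · have hs := (summable_norm_evalC h hw)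
    have e : evalC F w - ∑ i ∈ Finset.range m, ((PowerSeries.coeff i F : ℝ) : ℂ) * w ^ i =
        ∑' i, ((PowerSeries.coeff (i + m) F : ℝ) : ℂ) * w ^ (i + m) := by
      rw [evalC, ← hs.of_norm.sum_add_tsum_nat_add m]; ring
    rw [e]
    refine tsum_of_norm_bounded (g := fun i =>
      |PowerSeries.coeff (i + m) F| * x ^ (i + m) / x ^ m * ‖w‖ ^ m) ?_ ?_
    · exact ((h2.hasSum.div_const _).mul_right _)
    · intro i
      rw [norm_coeff_mul_pow, pow_add, pow_add]
      have : |PowerSeries.coeff (i + m) F| * (x ^ i * x ^ m) / x ^ m * ‖w‖ ^ m =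
        |PowerSeries.coeff (i + m) F| * (x ^ i * ‖w‖ ^ m) := by field_simp
      rw [this]
      gcongr

/-- Both claims go through one induction, because the Cauchy product needs absolute convergence of
the series of `F ^ n`. -/
theorem evalC_pow {F : PowerSeries ℝ} {x : ℝ} (hx : 0 ≤ x)
    (h : Summable fun i => |PowerSeries.coeff i F| * x ^ i) (n : ℕ) :
    (Summable fun i => |PowerSeries.coeff i (F ^ n)| * x ^ i) ∧
      ∀ w : ℂ, ‖w‖ ≤ x → evalC (F ^ n) w = evalC F w ^ n := by
  induction n with
  | zero =>
    constructor
    · refine summable_of_ne_finset_zero (s := {0}) fun i hi => ?_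
      simp only [Finset.mem_singleton] at hi
      simp [PowerSeries.coeff_one, hi]
    · intro w _
      rw [evalC, tsum_eq_single 0]
      · simp
      · intro i hi; simp [PowerSeries.coeff_one, hi]
  | succ n ih =>
    have key : ∀ (w : ℂ) (i : ℕ), ((PowerSeries.coeff i (F ^ (n + 1)) : ℝ) : ℂ) * w ^ i =
        ∑ kl ∈ Finset.HasAntidiagonal.antidiagonal i, (((PowerSeries.coeff kl.1 (F ^ n) : ℝ) : ℂ) * w ^ kl.1) *
          (((PowerSeries.coeff kl.2 F : ℝ) : ℂ) * w ^ kl.2) := by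
      intro w i
      rw [pow_succ, PowerSeries.coeff_mul]
      push_cast
      rw [Finset.sum_mul]
      refine Finset.sum_congr rfl fun kl hkl => ?_
      rw [← Finset.HasAntidiagonal.mem_antidiagonal.1 hkl, pow_add]; ring
    refine ⟨?_, fun w hw => ?_⟩
    · have hw : ‖(x : ℂ)‖ ≤ x := by simp [abs_of_nonneg hx]
      have := summable_norm_sum_mul_antidiagonal_of_summable_norm
        (summable_norm_evalC ih.1 hw) (summable_norm_evalC h hw)
      refine this.congr fun i => ?_
      rw [← key, norm_coeff_mul_pow]
      simp [abs_of_nonneg hx]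
    · have := tsum_mul_tsum_eq_tsum_sum_antidiagonal_of_summable_norm
        (summable_norm_evalC ih.1 hw) (summable_norm_evalC h hw)
      rw [pow_succ (evalC F w), ← ih.2 w hw]
      unfold evalC
      rw [this]
      exact tsum_congr fun i => key w i

theorem integral_exp_int_mul (m : ℤ) :
    ∫ θ in (-Real.pi)..Real.pi, Complex.exp (Complex.I * m * (θ : ℂ)) =
      if m = 0 then 2 * (Real.pi : ℂ) else 0 := by
  split_ifs with hm
  · subst hm
    simp; ring
  · rw [integral_exp_mul_complex (by simp [hm])]
    have : Complex.exp (Complex.I * m * (Real.pi : ℂ)) =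
        Complex.exp (Complex.I * m * ((-Real.pi : ℝ) : ℂ)) := by
      rw [Complex.exp_eq_exp_iff_exists_int]
      exact ⟨m, by push_cast; ring⟩
    rw [this]; simp

theorem coeff_eq_integral {F : PowerSeries ℝ} {r : ℝ} (hr : 0 < r)
    (h : Summable fun i => |PowerSeries.coeff i F| * r ^ i) (k : ℕ) :
    ∫ θ in (-Real.pi)..Real.pi, evalC F (r * Complex.exp (Complex.I * (θ : ℂ))) *
        Complex.exp (-(k : ℂ) * (Complex.I * (θ : ℂ))) =
      2 * Real.pi * (PowerSeries.coeff k F : ℝ) * r ^ k := by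
  have hn : ∀ θ : ℝ, ‖(r : ℂ) * Complex.exp (Complex.I * (θ : ℂ))‖ = r := by
    intro θ
    simp [Complex.norm_exp, abs_of_pos hr]
  have h1 := intervalIntegral.hasSum_integral_of_dominated_convergence
    (μ := MeasureTheory.volume) (a := -Real.pi) (b := Real.pi)
    (F := fun (i : ℕ) (θ : ℝ) => ((PowerSeries.coeff i F : ℝ) : ℂ) *
      (r * Complex.exp (Complex.I * (θ : ℂ))) ^ i * Complex.exp (-(k : ℂ) * (Complex.I * (θ : ℂ))))
    (f := fun θ : ℝ => evalC F (r * Complex.exp (Complex.I * (θ : ℂ))) *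
        Complex.exp (-(k : ℂ) * (Complex.I * (θ : ℂ))))
    (fun i _ => |PowerSeries.coeff i F| * r ^ i)
    (fun i => (by fun_prop : Continuous _).aestronglyMeasurable)
    (fun i => .of_forall fun θ _ => by
      rw [norm_mul, norm_coeff_mul_pow, hn]
      simp [Complex.norm_exp])
    (.of_forall fun _ _ => h) (by simp)
    (.of_forall fun θ _ => (hasSum_evalC h (hn θ).le).mul_right _)
  refine h1.unique ?_
  have h2 : ∀ i : ℕ, ∫ θ in (-Real.pi)..Real.pi, ((PowerSeries.coeff i F : ℝ) : ℂ) *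
      (r * Complex.exp (Complex.I * (θ : ℂ))) ^ i *
        Complex.exp (-(k : ℂ) * (Complex.I * (θ : ℂ))) =
      if i = k then 2 * (Real.pi : ℂ) * (PowerSeries.coeff k F : ℝ) * r ^ k else 0 := by
    intro i
    have : ∀ θ : ℝ, ((PowerSeries.coeff i F : ℝ) : ℂ) *
      (r * Complex.exp (Complex.I * (θ : ℂ))) ^ i *
        Complex.exp (-(k : ℂ) * (Complex.I * (θ : ℂ))) =
      ((PowerSeries.coeff i F : ℝ) : ℂ) * r ^ i *
        Complex.exp (Complex.I * (((i : ℤ) - (k : ℤ) : ℤ) : ℂ) * (θ : ℂ)) := by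
      intro θ
      rw [mul_pow, ← Complex.exp_nat_mul, mul_assoc, mul_assoc, ← Complex.exp_add, mul_assoc]
      congr 3
      push_cast; ring
    simp_rw [this]
    rw [intervalIntegral.integral_const_mul, integral_exp_int_mul]
    by_cases hik : i = k
    · subst hik; simp; ring
    · have : ¬ ((i : ℤ) - k = 0) := by omega
      simp [hik, this]
  simp_rw [h2]
  exact hasSum_ite_eq k _

/-! ### Taylor remainders and Gaussian moments. -/

section

open MeasureTheory

theorem norm_iteratedDeriv_div_factorial_le {h : ℂ → ℂ} {ρ B : ℝ} (hρ : 0 < ρ)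
    (hd : DifferentiableOn ℂ h (Metric.ball 0 (2 * ρ)))
    (hB : ∀ z : ℂ, ‖z‖ ≤ ρ → ‖h z‖ ≤ B) (m : ℕ) :
    ‖iteratedDeriv m h 0 / (m.factorial : ℂ)‖ ≤ B / ρ ^ m := by
  have hcl : DiffContOnCl ℂ h (Metric.ball 0 ρ) :=
    hd.diffContOnCl_ball (Metric.closedBall_subset_ball (by linarith))
  have := Complex.norm_iteratedDeriv_le_of_forall_mem_sphere_norm_le m hρ hcl
    (fun z hz => hB z (by simpa using (mem_sphere_zero_iff_norm.1 hz).le))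
  rw [norm_div, Complex.norm_natCast, div_le_iff₀ (by positivity)]
  calc _ ≤ _ := this
    _ = _ := by ring

/-- Cauchy's estimates bound the remainder by a geometric tail of ratio `‖z‖/ρ ≤ 1/2`, which
explains the factor 2. -/
theorem norm_sub_taylor_le {h : ℂ → ℂ} {ρ B : ℝ} (hρ : 0 < ρ)
    (hd : DifferentiableOn ℂ h (Metric.ball 0 (2 * ρ)))
    (hB : ∀ z : ℂ, ‖z‖ ≤ ρ → ‖h z‖ ≤ B) (M : ℕ) {z : ℂ} (hz : ‖z‖ ≤ ρ / 2) :
    ‖h z - ∑ m ∈ Finset.range M, iteratedDeriv m h 0 / (m.factorial : ℂ) * z ^ m‖ ≤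
      2 * B * (‖z‖ / ρ) ^ M := by
  have hs := Complex.hasSum_taylorSeries_on_ball hd (z := z) (by
    rw [mem_ball_zero_iff]; linarith)
  have hs' : HasSum (fun m => iteratedDeriv m h 0 / (m.factorial : ℂ) * z ^ m) (h z) := by
    refine hs.congr_fun ?_ |> fun h => h
    intro m
    simp only [sub_zero, smul_eq_mul]
    ring
  have hB0 : 0 ≤ B := (norm_nonneg _).trans (hB 0 (by simpa using hρ.le))
  set x := ‖z‖ / ρ with hx
  have hx0 : 0 ≤ x := by positivity
  have hx1 : x ≤ 1 / 2 := by rw [hx, div_le_iff₀ hρ]; linarith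
  rw [← hs'.tsum_eq, ← hs'.summable.sum_add_tsum_nat_add M, add_sub_cancel_left]
  have hg : HasSum (fun m => B * x ^ M * x ^ m) (B * x ^ M * (1 - x)⁻¹) :=
    (hasSum_geometric_of_lt_one hx0 (by linarith)).mul_left _
  refine (tsum_of_norm_bounded hg fun m => ?_).trans ?_
  · rw [norm_mul, norm_pow]
    calc _ ≤ B / ρ ^ (m + M) * ‖z‖ ^ (m + M) := by
            gcongr; exact norm_iteratedDeriv_div_factorial_le hρ hd hB _
      _ = B * x ^ M * x ^ m := by rw [hx, div_pow, div_pow, pow_add, pow_add]; field_simp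
  · have : (1 - x)⁻¹ ≤ 2 := by
      rw [inv_le_comm₀ (by linarith) (by norm_num)]; linarith
    calc B * x ^ M * (1 - x)⁻¹ ≤ B * x ^ M * 2 := by gcongr
      _ = _ := by ring

theorem norm_cexp_gaussian (s : ℝ) (b : ℂ) :
    ‖Complex.exp (-((s : ℂ) ^ 2 / 2) * b)‖ = Real.exp (-(b.re / 2) * s ^ 2) := by
  rw [Complex.norm_exp]
  congr 1
  have : -((s : ℂ) ^ 2 / 2) * b = ((-(s ^ 2 / 2) : ℝ) : ℂ) * b := by push_cast; ring
  rw [this, Complex.re_ofReal_mul]; ring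

theorem integrable_abs_pow_mul_exp {c : ℝ} (hc : 0 < c) (m : ℕ) :
    Integrable fun s : ℝ => |s| ^ m * Real.exp (-c * s ^ 2) := by
  have := (integrable_rpow_mul_exp_neg_mul_sq hc (s := m) (by
    have : (0 : ℝ) ≤ m := m.cast_nonneg
    linarith)).norm
  refine this.congr (.of_forall fun s => ?_)
  simp [Real.rpow_natCast]

theorem integrable_pow_mul_cexp {b : ℂ} (hb : 0 < b.re) (m : ℕ) :
    Integrable fun s : ℝ => (s : ℂ) ^ m * Complex.exp (-((s : ℂ) ^ 2 / 2) * b) := by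
  refine (integrable_abs_pow_mul_exp (c := b.re / 2) (by linarith) m).mono'
    (by fun_prop : Continuous _).aestronglyMeasurable (.of_forall fun s => ?_)
  rw [norm_mul, norm_cexp_gaussian]
  simp

/-- Integration by parts: the derivative of `s^(m+1) exp(-s²b/2)` has integral zero. -/
theorem integral_pow_add_two_mul_cexp {b : ℂ} (hb : 0 < b.re) (m : ℕ) :
    ∫ s : ℝ, (s : ℂ) ^ (m + 2) * Complex.exp (-((s : ℂ) ^ 2 / 2) * b) =
      (m + 1) / b * ∫ s : ℝ, (s : ℂ) ^ m * Complex.exp (-((s : ℂ) ^ 2 / 2) * b) := by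
  have hb0 : b ≠ 0 := by rintro rfl; simp at hb
  have hd : ∀ s : ℝ, HasDerivAt (fun s : ℝ => (s : ℂ) ^ (m + 1) *
      Complex.exp (-((s : ℂ) ^ 2 / 2) * b))
      ((m + 1) * ((s : ℂ) ^ m * Complex.exp (-((s : ℂ) ^ 2 / 2) * b)) -
        b * ((s : ℂ) ^ (m + 2) * Complex.exp (-((s : ℂ) ^ 2 / 2) * b))) s := by
    intro s
    have h1 : HasDerivAt (fun w : ℂ => w ^ (m + 1) * Complex.exp (-(w ^ 2 / 2) * b)) _ (s : ℂ) :=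
      (hasDerivAt_pow (m + 1) (s : ℂ)).mul
        ((((((hasDerivAt_pow 2 (s : ℂ)).div_const 2).neg).mul_const b)).cexp)
    refine h1.comp_ofReal.congr_deriv ?_
    push_cast
    have e : (-fun x : ℂ => x ^ 2 / 2) (s : ℂ) = -((s : ℂ) ^ 2 / 2) := rfl
    rw [e]
    ring
  have i1 := (integrable_pow_mul_cexp hb m).const_mul ((m : ℂ) + 1)
  have i2 := (integrable_pow_mul_cexp hb (m + 2)).const_mul b
  have := integral_eq_zero_of_hasDerivAt_of_integrable hd (i1.sub i2)
    (integrable_pow_mul_cexp hb (m + 1))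
  rw [integral_sub i1 i2, integral_const_mul, integral_const_mul, sub_eq_zero] at this
  rw [div_mul_eq_mul_div, this, mul_div_cancel_left₀ _ hb0]

theorem ofReal_mul_cpow {a : ℝ} (ha : 0 < a) {b : ℂ} (hb : b ≠ 0) (c : ℂ) :
    ((a : ℂ) * b) ^ c = (a : ℂ) ^ c * b ^ c := by
  have ha' : (a : ℂ) ≠ 0 := Complex.ofReal_ne_zero.2 ha.ne'
  rw [Complex.cpow_def_of_ne_zero (mul_ne_zero ha' hb), Complex.log_ofReal_mul ha hb,
    Complex.ofReal_log ha.le, add_mul, Complex.exp_add, ← Complex.cpow_def_of_ne_zero ha',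
    ← Complex.cpow_def_of_ne_zero hb]

theorem integral_even_pow_mul_cexp {b : ℂ} (hb : 0 < b.re) (ν : ℕ) :
    ∫ s : ℝ, (s : ℂ) ^ (2 * ν) * Complex.exp (-((s : ℂ) ^ 2 / 2) * b) =
      (√(2 * Real.pi) : ℝ) * ((2 * ν).factorial / (2 ^ ν * ν.factorial)) *
        b ^ (-(ν : ℂ) - 1 / 2) := by
  have hb0 : b ≠ 0 := by rintro rfl; simp at hb
  induction ν with
  | zero =>
    have := integral_gaussian_complex (b := b / 2) (by simpa using hb)
    have e : ∀ s : ℝ, (s : ℂ) ^ (2 * 0) * Complex.exp (-((s : ℂ) ^ 2 / 2) * b) =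
        Complex.exp (-(b / 2) * (s : ℂ) ^ 2) := by
      intro s; rw [mul_zero, pow_zero, one_mul]; congr 1; ring
    simp_rw [e]
    rw [this]
    have : (Real.pi : ℂ) / (b / 2) = ((2 * Real.pi : ℝ) : ℂ) * b⁻¹ := by
      push_cast; field_simp
    rw [this, ofReal_mul_cpow (by positivity) (inv_ne_zero hb0), Complex.inv_cpow, Real.sqrt_eq_rpow,
      Complex.ofReal_cpow (by positivity)]
    · simp [Complex.cpow_neg]
    -- Inverse and principal power commute off the negative axis, which `0 < b.re` excludes.
    · intro h
      have := Complex.arg_eq_pi_iff.1 h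
      linarith [this.1]
  | succ ν ih =>
    rw [show 2 * (ν + 1) = 2 * ν + 2 by ring, integral_pow_add_two_mul_cexp hb, ih]
    have : b ^ (-((ν + 1 : ℕ) : ℂ) - 1 / 2) = b ^ (-(ν : ℂ) - 1 / 2) / b := by
      rw [show -((ν + 1 : ℕ) : ℂ) - 1 / 2 = (-(ν : ℂ) - 1 / 2) - 1 by push_cast; ring,
        Complex.cpow_sub _ _ hb0, Complex.cpow_one]
    rw [this, Nat.factorial_succ (2 * ν + 1), Nat.factorial_succ (2 * ν), Nat.factorial_succ ν,
      pow_succ]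
    have h1 : (ν.factorial : ℂ) ≠ 0 := by exact_mod_cast ν.factorial_ne_zero
    have h2 : (ν : ℂ) + 1 ≠ 0 := by exact_mod_cast ν.succ_ne_zero
    push_cast
    field_simp
    ring

end

/-! ### A Laplace expansion uniform in the phase. -/

section

open MeasureTheory

/-- A derivative written as an integral over a fixed circle can be exchanged with the integral over
`s` by Fubini. -/
theorem iteratedDeriv_zero_eq_integral {h : ℂ → ℂ} {ρ : ℝ} (hρ : 0 < ρ)
    (hd : DifferentiableOn ℂ h (Metric.ball 0 (2 * ρ))) (m : ℕ) :
    iteratedDeriv m h 0 = (m.factorial / (2 * Real.pi * Complex.I) : ℂ) *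
      ∫ θ in (0 : ℝ)..2 * Real.pi,
        deriv (circleMap 0 ρ) θ / circleMap 0 ρ θ ^ (m + 1) * h (circleMap 0 ρ θ) := by
  have hsub : Metric.closedBall (0 : ℂ) ρ ⊆ Metric.ball 0 (2 * ρ) :=
    Metric.closedBall_subset_ball (by linarith)
  have := Complex.circleIntegral_one_div_sub_center_pow_smul_of_differentiable_on_off_countable
    hρ m Set.countable_empty (hd.continuousOn.mono hsub)
    (fun z hz => hd.differentiableAt
      (Metric.isOpen_ball.mem_nhds (hsub (Metric.ball_subset_closedBall hz.1))))
  simp only [circleIntegral, smul_eq_mul, sub_zero] at this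
  have e : ∀ θ : ℝ, deriv (circleMap 0 ρ) θ / circleMap 0 ρ θ ^ (m + 1) * h (circleMap 0 ρ θ) =
      deriv (circleMap 0 ρ) θ * (1 / circleMap 0 ρ θ ^ (m + 1) * h (circleMap 0 ρ θ)) := by
    intro θ; ring
  simp_rw [e]
  rw [this]
  have h1 : (m.factorial : ℂ) ≠ 0 := by exact_mod_cast m.factorial_ne_zero
  have h2 := Complex.two_pi_I_ne_zero
  field_simp

theorem circleMap_mem_ball {ρ : ℝ} (hρ : 0 < ρ) (θ : ℝ) :
    circleMap 0 ρ θ ∈ Metric.ball (0 : ℂ) (2 * ρ) := by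
  rw [mem_ball_zero_iff, norm_circleMap_zero, abs_of_pos hρ]; linarith

theorem continuous_circle_weight {ρ : ℝ} (hρ : 0 < ρ) (m : ℕ) :
    Continuous fun θ : ℝ => deriv (circleMap 0 ρ) θ / circleMap 0 ρ θ ^ (m + 1) := by
  simp only [deriv_circleMap]
  refine Continuous.div (by fun_prop) (by fun_prop) fun θ => ?_
  exact pow_ne_zero _ (circleMap_ne_center hρ.ne')

section

variable {ρ : ℝ} {φ : ℂ → ℂ}

theorem differentiableOn_cexp_gaussian (hd : DifferentiableOn ℂ φ (Metric.ball 0 (2 * ρ))) (s : ℝ) :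
    DifferentiableOn ℂ (fun z => Complex.exp (-((s : ℂ) ^ 2 / 2) * φ z))
      (Metric.ball 0 (2 * ρ)) :=
  (hd.const_mul _).cexp

theorem norm_cexp_gaussian_le (hre : ∀ z ∈ Metric.ball (0 : ℂ) (2 * ρ), 1 / 2 ≤ (φ z).re)
    (s : ℝ) {z : ℂ} (hz : z ∈ Metric.ball (0 : ℂ) (2 * ρ)) :
    ‖Complex.exp (-((s : ℂ) ^ 2 / 2) * φ z)‖ ≤ Real.exp (-(1 / 4) * s ^ 2) := by
  rw [norm_cexp_gaussian]
  apply Real.exp_le_exp.2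
  have := hre z hz
  nlinarith [sq_nonneg s]

/-- The hypothesis of Fubini: since `Re φ ≥ 1/2`, the factor `exp(-s²/4)` dominates uniformly along
the circle. -/
theorem integrable_circle_gaussian (hρ : 0 < ρ)
    (hd : DifferentiableOn ℂ φ (Metric.ball 0 (2 * ρ)))
    (hre : ∀ z ∈ Metric.ball (0 : ℂ) (2 * ρ), 1 / 2 ≤ (φ z).re) (m : ℕ) :
    Integrable (Function.uncurry fun (s θ : ℝ) => (s : ℂ) ^ m *
        (deriv (circleMap 0 ρ) θ / circleMap 0 ρ θ ^ (m + 1) *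
          Complex.exp (-((s : ℂ) ^ 2 / 2) * φ (circleMap 0 ρ θ))))
      (volume.prod (volume.restrict (Set.Ioc 0 (2 * Real.pi)))) := by
  have hφ : Continuous fun θ : ℝ => φ (circleMap 0 ρ θ) :=
    hd.continuousOn.comp_continuous (continuous_circleMap 0 ρ) (circleMap_mem_ball hρ)
  have hw := continuous_circle_weight hρ m
  have hwi : Integrable (fun θ : ℝ => ‖deriv (circleMap 0 ρ) θ / circleMap 0 ρ θ ^ (m + 1)‖)
      (volume.restrict (Set.Ioc 0 (2 * Real.pi))) :=
    (hw.norm.continuousOn.integrableOn_Icc).mono_set Set.Ioc_subset_Icc_self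
  refine ((integrable_abs_pow_mul_exp (c := 1 / 4) (by norm_num) m).mul_prod hwi).mono'
    ?_ (.of_forall fun p => ?_)
  · refine Continuous.aestronglyMeasurable ?_
    refine Continuous.mul (by fun_prop) (Continuous.mul (hw.comp continuous_snd) ?_)
    exact Continuous.cexp (Continuous.mul (by fun_prop) (hφ.comp continuous_snd))
  · simp only [Function.uncurry]
    rw [norm_mul, norm_mul, norm_pow, Complex.norm_real, Real.norm_eq_abs]
    have := norm_cexp_gaussian_le hre p.1 (circleMap_mem_ball hρ p.2)
    calc _ ≤ |p.1| ^ m * (‖deriv (circleMap 0 ρ) p.2 / circleMap 0 ρ p.2 ^ (m + 1)‖ *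
          Real.exp (-(1 / 4) * p.1 ^ 2)) := by gcongr
      _ = _ := by ring

theorem integrable_pow_mul_iteratedDeriv (hρ : 0 < ρ)
    (hd : DifferentiableOn ℂ φ (Metric.ball 0 (2 * ρ)))
    (hre : ∀ z ∈ Metric.ball (0 : ℂ) (2 * ρ), 1 / 2 ≤ (φ z).re) (m : ℕ) :
    Integrable fun s : ℝ => (s : ℂ) ^ m *
      iteratedDeriv m (fun z => Complex.exp (-((s : ℂ) ^ 2 / 2) * φ z)) 0 := by
  have := ((integrable_circle_gaussian hρ hd hre m).integral_prod_left).const_mul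
    (m.factorial / (2 * Real.pi * Complex.I) : ℂ)
  refine this.congr (.of_forall fun s => ?_)
  simp only [Function.uncurry]
  rw [iteratedDeriv_zero_eq_integral hρ (differentiableOn_cexp_gaussian hd s) m,
    intervalIntegral.integral_of_le Real.two_pi_pos.le, integral_const_mul]
  ring

/-- The source of `φ^(-ν-1/2)` in `c_ν`: after Fubini the Gaussian moment is computed at each fixed
point of the circle, where it is a power of `φ`, and Cauchy's formula is then read backwards. -/
theorem integral_pow_mul_iteratedDeriv_even (hρ : 0 < ρ)
    (hd : DifferentiableOn ℂ φ (Metric.ball 0 (2 * ρ)))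
    (hre : ∀ z ∈ Metric.ball (0 : ℂ) (2 * ρ), 1 / 2 ≤ (φ z).re) (ν : ℕ) :
    ∫ s : ℝ, (s : ℂ) ^ (2 * ν) *
      iteratedDeriv (2 * ν) (fun z => Complex.exp (-((s : ℂ) ^ 2 / 2) * φ z)) 0 =
    (√(2 * Real.pi) : ℝ) * ((2 * ν).factorial / (2 ^ ν * ν.factorial)) *
      iteratedDeriv (2 * ν) (fun z => φ z ^ (-(ν : ℂ) - 1 / 2)) 0 := by
  have hpos : ∀ z ∈ Metric.ball (0 : ℂ) (2 * ρ), 0 < (φ z).re := fun z hz => by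
    linarith [hre z hz]
  have hd' : DifferentiableOn ℂ (fun z => φ z ^ (-(ν : ℂ) - 1 / 2)) (Metric.ball 0 (2 * ρ)) :=
    hd.cpow (differentiableOn_const _) fun z hz => Or.inl (hpos z hz)
  have swap := integral_integral_swap (integrable_circle_gaussian hρ hd hre (2 * ν))
  rw [iteratedDeriv_zero_eq_integral hρ hd']
  have e1 : ∀ s : ℝ, (s : ℂ) ^ (2 * ν) *
      iteratedDeriv (2 * ν) (fun z => Complex.exp (-((s : ℂ) ^ 2 / 2) * φ z)) 0 =
      ((2 * ν).factorial / (2 * Real.pi * Complex.I) : ℂ) *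
        ∫ θ in Set.Ioc 0 (2 * Real.pi), (s : ℂ) ^ (2 * ν) *
        (deriv (circleMap 0 ρ) θ / circleMap 0 ρ θ ^ (2 * ν + 1) *
          Complex.exp (-((s : ℂ) ^ 2 / 2) * φ (circleMap 0 ρ θ))) := by
    intro s
    rw [iteratedDeriv_zero_eq_integral hρ (differentiableOn_cexp_gaussian hd s),
      intervalIntegral.integral_of_le Real.two_pi_pos.le, integral_const_mul]
    ring
  have e2 : ∀ θ : ℝ, ∫ s : ℝ, (s : ℂ) ^ (2 * ν) *
        (deriv (circleMap 0 ρ) θ / circleMap 0 ρ θ ^ (2 * ν + 1) *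
          Complex.exp (-((s : ℂ) ^ 2 / 2) * φ (circleMap 0 ρ θ))) =
      (√(2 * Real.pi) : ℝ) * ((2 * ν).factorial / (2 ^ ν * ν.factorial)) *
        (deriv (circleMap 0 ρ) θ / circleMap 0 ρ θ ^ (2 * ν + 1) *
          φ (circleMap 0 ρ θ) ^ (-(ν : ℂ) - 1 / 2)) := by
    intro θ
    have := integral_even_pow_mul_cexp (hpos _ (circleMap_mem_ball hρ θ)) ν
    calc _ = ∫ s : ℝ, deriv (circleMap 0 ρ) θ / circleMap 0 ρ θ ^ (2 * ν + 1) *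
          ((s : ℂ) ^ (2 * ν) * Complex.exp (-((s : ℂ) ^ 2 / 2) * φ (circleMap 0 ρ θ))) := by
            congr 1; ext s; ring
      _ = _ := by rw [integral_const_mul, this]; ring
  simp_rw [e1]
  rw [integral_const_mul, swap]
  simp_rw [e2]
  rw [integral_const_mul, intervalIntegral.integral_of_le Real.two_pi_pos.le]
  ring

/-- The derivative depends on `s` only through `s²`, so the integrand is odd. -/
theorem integral_pow_mul_iteratedDeriv_odd (φ : ℂ → ℂ) (ν : ℕ) :
    ∫ s : ℝ, (s : ℂ) ^ (2 * ν + 1) *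
      iteratedDeriv (2 * ν + 1) (fun z => Complex.exp (-((s : ℂ) ^ 2 / 2) * φ z)) 0 = 0 := by
  have h := integral_neg_eq_self (fun s : ℝ => (s : ℂ) ^ (2 * ν + 1) *
      iteratedDeriv (2 * ν + 1) (fun z => Complex.exp (-((s : ℂ) ^ 2 / 2) * φ z)) 0) volume
  have e : ∀ s : ℝ, ((-s : ℝ) : ℂ) ^ (2 * ν + 1) *
      iteratedDeriv (2 * ν + 1) (fun z => Complex.exp (-(((-s : ℝ) : ℂ) ^ 2 / 2) * φ z)) 0 =
      -((s : ℂ) ^ (2 * ν + 1) *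
      iteratedDeriv (2 * ν + 1) (fun z => Complex.exp (-((s : ℂ) ^ 2 / 2) * φ z)) 0) := by
    intro s
    have h1 : ((-s : ℝ) : ℂ) ^ (2 * ν + 1) = -(s : ℂ) ^ (2 * ν + 1) := by
      push_cast; exact Odd.neg_pow ⟨ν, rfl⟩ _
    have h2 : ((-s : ℝ) : ℂ) ^ 2 = (s : ℂ) ^ 2 := by push_cast; ring
    rw [h1, h2, neg_mul]
  simp_rw [e] at h
  rw [integral_neg] at h
  exact self_eq_neg.1 h.symm

end

theorem sum_range_two_mul {a : ℕ → ℂ} (h : ∀ ν, a (2 * ν + 1) = 0) (N : ℕ) :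
    ∑ m ∈ Finset.range (2 * N), a m = ∑ ν ∈ Finset.range N, a (2 * ν) := by
  induction N with
  | zero => simp
  | succ N ih =>
    rw [show 2 * (N + 1) = 2 * N + 1 + 1 by ring, Finset.sum_range_succ, Finset.sum_range_succ, h,
      ih, Finset.sum_range_succ, add_zero]

/-- With `s = √t θ`, the function `z ↦ exp(-s²φ(z)/2)` is Taylor expanded at 0 to order `2(N+1)` and
evaluated at `z = is/√t`, while `s` inside the exponential stays fixed. The Taylor terms are
integrated over the whole line: odd orders vanish, even orders give the sum. Only `ρ` and `Re φ ≥
1/2` enter the error, hence `C` precedes `φ`. -/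
theorem laplace_expansion {ρ : ℝ} (hρ : 0 < ρ) (N : ℕ) : ∃ C : ℝ, 0 ≤ C ∧ ∀ φ : ℂ → ℂ,
    DifferentiableOn ℂ φ (Metric.ball 0 (2 * ρ)) →
    (∀ z ∈ Metric.ball (0 : ℂ) (2 * ρ), 1 / 2 ≤ (φ z).re) → ∀ t : ℝ, 0 < t →
    ‖(√(t / (2 * Real.pi)) : ℝ) * (∫ θ in (-(ρ / 2))..(ρ / 2),
          Complex.exp (-((t * θ ^ 2 / 2 : ℝ) : ℂ) * φ (Complex.I * θ))) -
        ∑ ν ∈ Finset.range (N + 1), (-1 : ℂ) ^ ν / ((2 * t) ^ ν * ν.factorial) *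
          iteratedDeriv (2 * ν) (fun z => φ z ^ (-(ν : ℂ) - 1 / 2)) 0‖ ≤ C / t ^ (N + 1) := by
  set M := 2 * (N + 1) with hM
  set A := ∫ s : ℝ, |s| ^ M * Real.exp (-(1 / 4) * s ^ 2) with hA
  have hA0 : 0 ≤ A := integral_nonneg fun s => by positivity
  refine ⟨(√(2 * Real.pi))⁻¹ * ((2 + M * 2 ^ M) / ρ ^ M * A), by positivity,
    fun φ hd hre t ht => ?_⟩
  set u := √t with hu
  have hu0 : 0 < u := Real.sqrt_pos.2 ht
  have hut : u ^ 2 = t := Real.sq_sqrt ht.le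
  set D : ℕ → ℝ → ℂ := fun m s =>
    iteratedDeriv m (fun z => Complex.exp (-((s : ℂ) ^ 2 / 2) * φ z)) 0 with hD
  set J : ℕ → ℂ := fun m => ∫ s : ℝ, (s : ℂ) ^ m * D m s with hJ
  -- rescaling
  have hI : ∫ θ in (-(ρ / 2))..(ρ / 2),
      Complex.exp (-((t * θ ^ 2 / 2 : ℝ) : ℂ) * φ (Complex.I * θ)) =
      (u⁻¹ : ℝ) * ∫ s in (-(u * (ρ / 2)))..(u * (ρ / 2)),
        Complex.exp (-((s : ℂ) ^ 2 / 2) * φ (Complex.I * s / u)) := by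
    have := intervalIntegral.integral_comp_mul_left (a := -(ρ / 2)) (b := ρ / 2)
      (fun s : ℝ => Complex.exp (-((s : ℂ) ^ 2 / 2) * φ (Complex.I * s / u))) hu0.ne'
    rw [mul_neg] at this
    rw [← Complex.real_smul, ← this]
    refine intervalIntegral.integral_congr fun θ _ => ?_
    have hu' : (u : ℂ) ≠ 0 := Complex.ofReal_ne_zero.2 hu0.ne'
    have e1 : Complex.I * ((u * θ : ℝ) : ℂ) / u = Complex.I * θ := by
      push_cast; field_simp
    simp only [e1, ← hut]
    congr 2
    push_cast; ring
  have hsqrt : √(t / (2 * Real.pi)) = (√(2 * Real.pi))⁻¹ * u := by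
    rw [Real.sqrt_div ht.le, div_eq_inv_mul]
  have hsum : ∑ ν ∈ Finset.range (N + 1), (-1 : ℂ) ^ ν / ((2 * t) ^ ν * ν.factorial) *
      iteratedDeriv (2 * ν) (fun z => φ z ^ (-(ν : ℂ) - 1 / 2)) 0 =
      ((√(2 * Real.pi))⁻¹ : ℝ) *
        ∑ m ∈ Finset.range M, (Complex.I / u) ^ m / m.factorial * J m := by
    rw [hM, sum_range_two_mul, Finset.mul_sum]
    · refine Finset.sum_congr rfl fun ν _ => ?_
      simp only [hJ, hD]
      rw [integral_pow_mul_iteratedDeriv_even hρ hd hre, pow_mul, div_pow, Complex.I_sq]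
      have hπ : ((√(2 * Real.pi) : ℝ) : ℂ) ≠ 0 := Complex.ofReal_ne_zero.2 (by positivity)
      have h2 : ((2 * ν).factorial : ℂ) ≠ 0 := by exact_mod_cast (2 * ν).factorial_ne_zero
      have hut' : (u : ℂ) ^ 2 = t := by exact_mod_cast hut
      have ht' : (t : ℂ) ≠ 0 := Complex.ofReal_ne_zero.2 ht.ne'
      rw [hut', Complex.ofReal_inv, mul_pow, div_pow]
      field_simp
    · intro ν
      simp only [hJ, hD]
      rw [integral_pow_mul_iteratedDeriv_odd, mul_zero]
  set S := Set.Ioc (-(u * (ρ / 2))) (u * (ρ / 2)) with hS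
  set e : ℝ → ℂ := fun s => Complex.exp (-((s : ℂ) ^ 2 / 2) * φ (Complex.I * s / u)) with he
  have hnorm : ∀ s : ℝ, ‖Complex.I * s / u‖ = |s| / u := by
    intro s; simp [abs_of_pos hu0]
  have hSabs : ∀ s ∈ S, |s| / u ≤ ρ / 2 := by
    intro s hs
    rw [div_le_iff₀ hu0, abs_le]
    constructor <;> nlinarith [hs.1, hs.2]
  have hei : Integrable (S.indicator e) := by
    rw [integrable_indicator_iff measurableSet_Ioc]
    refine (ContinuousOn.integrableOn_Icc ?_).mono_set Set.Ioc_subset_Icc_self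
    refine ContinuousOn.cexp (ContinuousOn.mul (by fun_prop)
      (hd.continuousOn.comp (by fun_prop) fun s hs => ?_))
    rw [mem_ball_zero_iff, hnorm, div_lt_iff₀ hu0, abs_lt]
    constructor <;> nlinarith [hs.1, hs.2, mul_pos hu0 hρ]
  have hPi : ∀ m ∈ Finset.range M, Integrable fun s : ℝ =>
      (Complex.I / u) ^ m / m.factorial * ((s : ℂ) ^ m * D m s) := fun m _ =>
    (integrable_pow_mul_iteratedDeriv hρ hd hre m).const_mul _
  -- One pointwise bound covers both errors: 2 comes from the Taylor remainder inside the window, `M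
  -- * 2 ^ M` from the polynomial outside it.
  have hmain : ∀ s : ℝ, ‖S.indicator e s - ∑ m ∈ Finset.range M,
      (Complex.I / u) ^ m / m.factorial * ((s : ℂ) ^ m * D m s)‖ ≤
      (2 + M * 2 ^ M) / (ρ * u) ^ M * (|s| ^ M * Real.exp (-(1 / 4) * s ^ 2)) := by
    intro s
    set B := Real.exp (-(1 / 4) * s ^ 2) with hB
    have hds := differentiableOn_cexp_gaussian hd s
    have hbd : ∀ z : ℂ, ‖z‖ ≤ ρ → ‖Complex.exp (-((s : ℂ) ^ 2 / 2) * φ z)‖ ≤ B := fun z hz =>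
      norm_cexp_gaussian_le hre s (by rw [mem_ball_zero_iff]; linarith)
    have hterm : ∀ m, (Complex.I / u) ^ m / m.factorial * ((s : ℂ) ^ m * D m s) =
        D m s / m.factorial * (Complex.I * s / u) ^ m := by
      intro m
      rw [div_pow, div_pow, mul_pow]; ring
    simp_rw [hterm]
    set x := |s| / u / ρ with hx
    have hx0 : 0 ≤ x := by positivity
    have hrhs : (2 + M * 2 ^ M) / (ρ * u) ^ M * (|s| ^ M * B) = (2 + M * 2 ^ M) * (B * x ^ M) := by
      rw [hx, div_pow, div_pow, mul_pow]; field_simp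
    rw [hrhs]
    have hBx : 0 ≤ B * x ^ M := by positivity
    by_cases hs : s ∈ S
    · rw [Set.indicator_of_mem hs]
      have := norm_sub_taylor_le hρ hds hbd M (z := Complex.I * s / u) (by
        rw [hnorm]; exact hSabs s hs)
      rw [hnorm] at this
      refine this.trans ?_
      have h3 : (0 : ℝ) ≤ M * 2 ^ M * (B * x ^ M) := by positivity
      nlinarith
    -- Outside the window only the Taylor polynomial is left; there `2x ≥ 1`, so every lower power
    -- of `x` is at most `(2x)^M`.
    · rw [Set.indicator_of_notMem hs, zero_sub, norm_neg]
      have hx2 : 1 ≤ 2 * x := by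
        have : u * (ρ / 2) ≤ |s| := by
          by_contra hlt
          push Not at hlt
          exact hs ⟨by linarith [neg_abs_le s], by linarith [le_abs_self s]⟩
        rw [hx]
        have : 1 / 2 ≤ |s| / u / ρ := by
          rw [div_div, le_div_iff₀ (by positivity)]; linarith
        linarith
      calc _ ≤ ∑ m ∈ Finset.range M, (2 ^ M * (B * x ^ M)) := by
            refine norm_sum_le_of_le _ fun m hm => ?_
            rw [norm_mul, norm_pow, hnorm]
            have hc := norm_iteratedDeriv_div_factorial_le hρ hds hbd m
            calc _ ≤ B / ρ ^ m * (|s| / u) ^ m := by gcongr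
              _ = B * x ^ m := by rw [hx, div_pow _ ρ]; ring
              _ ≤ B * (2 * x) ^ M := by
                have h5 : x ^ m ≤ (2 * x) ^ m := by gcongr; linarith
                have h6 : (2 * x) ^ m ≤ (2 * x) ^ M :=
                  pow_le_pow_right₀ hx2 (Finset.mem_range.1 hm).le
                have := h5.trans h6
                gcongr
              _ = _ := by rw [mul_pow]; ring
        _ = M * 2 ^ M * (B * x ^ M) := by simp; ring
        _ ≤ _ := by nlinarith
  rw [hsqrt, hI, hsum]
  have e3 : (((√(2 * Real.pi))⁻¹ * u : ℝ) : ℂ) * ((u⁻¹ : ℝ) *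
      ∫ s in (-(u * (ρ / 2)))..(u * (ρ / 2)), e s) = ((√(2 * Real.pi))⁻¹ : ℝ) *
        ∫ s, S.indicator e s := by
    rw [integral_indicator measurableSet_Ioc, intervalIntegral.integral_of_le (by nlinarith)]
    have hu' : (u : ℂ) ≠ 0 := Complex.ofReal_ne_zero.2 hu0.ne'
    push_cast
    field_simp
  have e4 : ∑ m ∈ Finset.range M, (Complex.I / u) ^ m / m.factorial * J m =
      ∫ s : ℝ, ∑ m ∈ Finset.range M, (Complex.I / u) ^ m / m.factorial * ((s : ℂ) ^ m * D m s) := by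
    rw [integral_finsetSum _ hPi]
    refine Finset.sum_congr rfl fun m _ => ?_
    rw [integral_const_mul]
  rw [e3, e4, ← mul_sub, ← integral_sub hei (integrable_finsetSum _ hPi), norm_mul,
    Complex.norm_real, Real.norm_of_nonneg (by positivity), mul_div_assoc]
  gcongr
  calc _ ≤ ∫ s, (2 + M * 2 ^ M) / (ρ * u) ^ M * (|s| ^ M * Real.exp (-(1 / 4) * s ^ 2)) :=
        norm_integral_le_of_norm_le
          ((integrable_abs_pow_mul_exp (by norm_num) M).const_mul _) (.of_forall hmain)
    _ = _ := by
      rw [integral_const_mul, ← hA, mul_pow, hM, pow_mul u, hut]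
      field_simp

end

/-! ### Behaviour of `log f`, `μ`, `σ` and `φ` for small `r`. -/

/-- Links the real derivatives in `mu` and `sigma` to complex derivatives of holomorphic extensions.
-/
theorem hasDerivAt_of_ofReal_eq {m : ℂ → ℂ} {g : ℝ → ℝ} {x : ℝ} (hm : DifferentiableAt ℂ m x)
    (h : ∀ᶠ y : ℝ in 𝓝 x, m y = (g y : ℂ)) :
    HasDerivAt m ((deriv g x : ℝ) : ℂ) x ∧ HasDerivAt g (deriv g x) x := by
  have h1 : HasDerivAt (fun y : ℝ => (m y).re) (deriv m x).re x := hm.hasDerivAt.real_of_complex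
  have h2 : HasDerivAt g (deriv m x).re x :=
    h1.congr_of_eventuallyEq (h.mono fun y hy => by simp [hy])
  have h3 : HasDerivAt g (deriv g x) x := by rw [h2.deriv]; exact h2
  refine ⟨?_, h3⟩
  have h4 : HasDerivAt (fun y : ℝ => m y) (deriv m x) x := hm.hasDerivAt.comp_ofReal
  have h5 : HasDerivAt (fun y : ℝ => m y) ((deriv g x : ℝ) : ℂ) x :=
    (h3.ofReal_comp).congr_of_eventuallyEq h
  rw [← h4.unique h5]
  exact hm.hasDerivAt

section

variable {F : PowerSeries ℝ} {x : ℝ}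

theorem differentiableAt_evalC (h : Summable fun i => |PowerSeries.coeff i F| * x ^ i) {w : ℂ}
    (hw : ‖w‖ < x) : DifferentiableAt ℂ (evalC F) w :=
  (differentiableOn_evalC h).differentiableAt
    (Metric.isOpen_ball.mem_nhds (by rwa [mem_ball_zero_iff]))

theorem hasDerivAt_evalR (h : Summable fun i => |PowerSeries.coeff i F| * x ^ i) {r : ℝ}
    (hr : |r| < x) : HasDerivAt (evalC F) ((deriv (evalR F) r : ℝ) : ℂ) r ∧
      HasDerivAt (evalR F) (deriv (evalR F) r) r :=
  hasDerivAt_of_ofReal_eq (differentiableAt_evalC h (by simpa using hr))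
    (.of_forall fun y => evalC_ofReal F y)

/-- The holomorphic extension `w f'(w) / f(w)` of `mu`. -/
def muC (F : PowerSeries ℝ) (w : ℂ) : ℂ := w * deriv (evalC F) w / evalC F w

theorem differentiableAt_muC (h : Summable fun i => |PowerSeries.coeff i F| * x ^ i) {w : ℂ}
    (hw : ‖w‖ < x) (h0 : evalC F w ≠ 0) : DifferentiableAt ℂ (muC F) w := by
  have hmem : Metric.ball (0 : ℂ) x ∈ 𝓝 w :=
    Metric.isOpen_ball.mem_nhds (by rwa [mem_ball_zero_iff])
  have h1 : DifferentiableAt ℂ (deriv (evalC F)) w :=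
    ((differentiableOn_evalC h).deriv Metric.isOpen_ball).differentiableAt hmem
  exact (differentiableAt_id.mul h1).div (differentiableAt_evalC h hw) h0

theorem muC_ofReal (h : Summable fun i => |PowerSeries.coeff i F| * x ^ i) {r : ℝ}
    (hr : |r| < x) : muC F r = (mu F r : ℂ) := by
  rw [muC, mu, (hasDerivAt_evalR h hr).1.deriv, evalC_ofReal]
  push_cast; rfl

theorem hasDerivAt_mu (h : Summable fun i => |PowerSeries.coeff i F| * x ^ i) {r : ℝ}
    (hr : |r| < x) (h0 : evalR F r ≠ 0) : HasDerivAt (muC F) ((deriv (mu F) r : ℝ) : ℂ) r ∧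
      HasDerivAt (mu F) (deriv (mu F) r) r := by
  refine hasDerivAt_of_ofReal_eq (differentiableAt_muC h (by simpa using hr)
    (by rw [evalC_ofReal]; exact_mod_cast h0)) ?_
  have : ∀ᶠ y : ℝ in 𝓝 r, |y| < x := (continuous_abs.tendsto r).eventually_lt_const hr
  filter_upwards [this] with y hy using muC_ofReal h hy

theorem coeff_eq_zero_of_lt_minExp {i : ℕ} (h0 : 0 < i) (hi : i < minExp F) :
    PowerSeries.coeff i F = 0 := by
  by_contra hne
  exact Nat.notMem_of_lt_sInf hi ⟨h0, hne⟩

theorem sum_range_minExp (h0 : PowerSeries.coeff 0 F = 1) (hl : 0 < minExp F) (w : ℂ) :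
    ∑ i ∈ Finset.range (minExp F), ((PowerSeries.coeff i F : ℝ) : ℂ) * w ^ i = 1 := by
  rw [Finset.sum_eq_single_of_mem 0 (Finset.mem_range.2 hl)]
  · simp [h0]
  · intro i hi hi0
    rw [coeff_eq_zero_of_lt_minExp (Nat.pos_of_ne_zero hi0) (Finset.mem_range.1 hi)]
    simp

/-- As `f - 1 = O(w^l)`, the logarithm differs from `f - 1` by `O(w^{2l})`, which is within the
error because `l ≥ 1`. -/
theorem log_evalC_near_zero (h0 : PowerSeries.coeff 0 F = 1) (hl : 0 < minExp F) (hx : 0 < x)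
    (h : Summable fun i => |PowerSeries.coeff i F| * x ^ i) :
    ∃ y C : ℝ, 0 < y ∧ y < x ∧ y ≤ 1 ∧ 0 ≤ C ∧ ∀ w : ℂ, ‖w‖ ≤ y → ‖evalC F w - 1‖ ≤ 1 / 2 ∧
      ‖Complex.log (evalC F w) - (PowerSeries.coeff (minExp F) F : ℝ) * w ^ minExp F‖ ≤
        C * ‖w‖ ^ (minExp F + 1) := by
  set l := minExp F with hldef
  obtain ⟨C1, hC1, H1⟩ := norm_evalC_sub_sum_le hx h l
  obtain ⟨C2, hC2, H2⟩ := norm_evalC_sub_sum_le hx h (l + 1)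
  -- The radius ensures `C1 ‖w‖ ≤ 1/2`; `C1 ^ 2` pays for the quadratic part of the logarithm and
  -- `C2` for the series tail.
  refine ⟨min (x / 2) (min 1 (1 / (2 * (C1 + 1)))), C1 ^ 2 + C2, by positivity,
    (min_le_left _ _).trans_lt (by linarith), (min_le_right _ _).trans (min_le_left _ _),
    by positivity, fun w hw => ?_⟩
  have hwx : ‖w‖ ≤ x := by linarith [hw.trans (min_le_left _ _)]
  have hw1 : ‖w‖ ≤ 1 := hw.trans ((min_le_right _ _).trans (min_le_left _ _))
  have hw2 : ‖w‖ ≤ 1 / (2 * (C1 + 1)) := hw.trans ((min_le_right _ _).trans (min_le_right _ _))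
  rw [le_div_iff₀ (by positivity)] at hw2
  have a1 := H1 w hwx
  have a2 := H2 w hwx
  rw [Finset.sum_range_succ, hldef, sum_range_minExp h0 hl] at a2
  rw [hldef, sum_range_minExp h0 hl] at a1
  have hpl : ‖w‖ ^ l ≤ ‖w‖ := pow_le_of_le_one (norm_nonneg _) hw1 hl.ne'
  have hle : ‖evalC F w - 1‖ ≤ 1 / 2 := by
    refine a1.trans ?_
    have : C1 * ‖w‖ ^ l ≤ C1 * ‖w‖ := by gcongr
    nlinarith [norm_nonneg w]
  refine ⟨hle, ?_⟩
  have hlog := Complex.norm_log_one_add_sub_self_le (z := evalC F w - 1) (by linarith)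
  rw [add_sub_cancel] at hlog
  have hinv : (1 - ‖evalC F w - 1‖)⁻¹ ≤ 2 := by
    rw [inv_le_comm₀ (by linarith) (by norm_num)]; linarith
  have hsq : ‖evalC F w - 1‖ ^ 2 * (1 - ‖evalC F w - 1‖)⁻¹ / 2 ≤ C1 ^ 2 * ‖w‖ ^ (l + 1) := by
    calc _ ≤ ‖evalC F w - 1‖ ^ 2 * 2 / 2 := by gcongr
      _ = ‖evalC F w - 1‖ ^ 2 := by ring
      _ ≤ (C1 * ‖w‖ ^ l) ^ 2 := by gcongr
      _ = C1 ^ 2 * (‖w‖ ^ l * ‖w‖ ^ l) := by ring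
      _ ≤ C1 ^ 2 * (‖w‖ ^ l * ‖w‖) := by gcongr
      _ = _ := by rw [pow_succ ‖w‖]
  calc _ = ‖(Complex.log (evalC F w) - (evalC F w - 1)) + (evalC F w -
          (1 + (PowerSeries.coeff l F : ℝ) * w ^ l))‖ := by congr 1; ring
    _ ≤ C1 ^ 2 * ‖w‖ ^ (l + 1) + C2 * ‖w‖ ^ (l + 1) :=
        (norm_add_le _ _).trans (add_le_add (hlog.trans hsq) a2)
    _ = _ := by ring

/-- `log (f(r e^z) / f(r))`. -/
def logRatio (F : PowerSeries ℝ) (r : ℝ) (z : ℂ) : ℂ :=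
  Complex.log (evalC F ((r : ℂ) * Complex.exp z) / (evalR F r : ℂ))

theorem half_le_re_of_norm_sub_one_le {w : ℂ} (h : ‖w - 1‖ ≤ 1 / 2) : 1 / 2 ≤ w.re := by
  have := (Complex.abs_re_le_norm (w - 1)).trans h
  rw [abs_le] at this
  simp only [Complex.sub_re, Complex.one_re] at this
  linarith [this.1]

theorem logRatio_eq {r : ℝ} {z : ℂ} (hr : 0 < evalR F r)
    (hz : evalC F ((r : ℂ) * Complex.exp z) ≠ 0) :
    logRatio F r z = Complex.log (evalC F ((r : ℂ) * Complex.exp z)) -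
      Complex.log (evalC F r) := by
  have : evalC F ((r : ℂ) * Complex.exp z) / (evalR F r : ℂ) =
      (((evalR F r)⁻¹ : ℝ) : ℂ) * evalC F ((r : ℂ) * Complex.exp z) := by
    push_cast; rw [div_eq_inv_mul]
  rw [logRatio, this, Complex.log_ofReal_mul (inv_pos.2 hr) hz, evalC_ofReal, Real.log_inv,
    ← Complex.ofReal_log hr.le]
  push_cast; ring

theorem hasDerivAt_logRatio (h : Summable fun i => |PowerSeries.coeff i F| * x ^ i) {r : ℝ}
    {z : ℂ} (hz : ‖(r : ℂ) * Complex.exp z‖ < x) (hr : 0 < evalR F r)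
    (hre : 0 < (evalC F ((r : ℂ) * Complex.exp z)).re) :
    HasDerivAt (logRatio F r) (muC F ((r : ℂ) * Complex.exp z)) z := by
  have h1 : HasDerivAt (fun z => (r : ℂ) * Complex.exp z) ((r : ℂ) * Complex.exp z) z :=
    (Complex.hasDerivAt_exp z).const_mul _
  have h2 : HasDerivAt (fun z => evalC F ((r : ℂ) * Complex.exp z))
      (deriv (evalC F) ((r : ℂ) * Complex.exp z) * ((r : ℂ) * Complex.exp z)) z :=
    HasDerivAt.comp (h₂ := evalC F) z (differentiableAt_evalC h hz).hasDerivAt h1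
  have hne : evalC F ((r : ℂ) * Complex.exp z) ≠ 0 := by
    intro h; rw [h] at hre; simp at hre
  have hr' : (evalR F r : ℂ) ≠ 0 := Complex.ofReal_ne_zero.2 hr.ne'
  have h3 := (h2.div_const (evalR F r : ℂ)).clog (by
    left
    rw [Complex.div_ofReal_re]; positivity)
  refine h3.congr_deriv ?_
  rw [muC]; field_simp

/-- The substitution `w = r e^z` turns `d/dz` into `w d/dw`, and `μ`, `σ` are the first two such
derivatives of `log f`. -/
theorem iteratedDeriv_logRatio (h : Summable fun i => |PowerSeries.coeff i F| * x ^ i) {r : ℝ}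
    (hr : 0 < r) (hrx : r < x) (hfr : 0 < evalR F r)
    (hd : ∀ᶠ z in 𝓝 0, HasDerivAt (logRatio F r) (muC F ((r : ℂ) * Complex.exp z)) z) :
    iteratedDeriv 1 (logRatio F r) 0 = mu F r ∧ iteratedDeriv 2 (logRatio F r) 0 = sigma F r := by
  have hrx' : |r| < x := by rwa [abs_of_pos hr]
  constructor
  · rw [iteratedDeriv_one, hd.self_of_nhds.deriv, Complex.exp_zero, mul_one, muC_ofReal h hrx']
  · rw [iteratedDeriv_succ, iteratedDeriv_one]
    have hev : deriv (logRatio F r) =ᶠ[𝓝 0] fun z => muC F ((r : ℂ) * Complex.exp z) :=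
      hd.mono fun z hz => hz.deriv
    rw [hev.deriv_eq]
    have h1 : HasDerivAt (fun z => (r : ℂ) * Complex.exp z) ((r : ℂ) * Complex.exp 0) 0 :=
      (Complex.hasDerivAt_exp 0).const_mul _
    have h2 := (hasDerivAt_mu h hrx' hfr.ne').1
    have h2' : HasDerivAt (muC F) ((deriv (mu F) r : ℝ) : ℂ) ((r : ℂ) * Complex.exp 0) := by
      rwa [Complex.exp_zero, mul_one]
    have := (HasDerivAt.comp (0 : ℂ) h2' h1).deriv
    rw [show (muC F ∘ fun z => (r : ℂ) * Complex.exp z) =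
      fun z => muC F ((r : ℂ) * Complex.exp z) from rfl] at this
    rw [this, sigma, Complex.exp_zero, mul_one]
    push_cast; ring

theorem iteratedDeriv_mul_exp_sub_one (A : ℂ) (l : ℕ) :
    iteratedDeriv 1 (fun z : ℂ => A * (Complex.exp (l * z) - 1)) 0 = A * l ∧
    iteratedDeriv 2 (fun z : ℂ => A * (Complex.exp (l * z) - 1)) 0 = A * l ^ 2 := by
  have hd : deriv (fun z : ℂ => A * (Complex.exp (l * z) - 1)) =
      fun z => A * (Complex.exp (l * z) * (l * 1)) := by
    ext z
    exact (((((hasDerivAt_id z).const_mul (l : ℂ)).cexp).sub_const 1).const_mul _).deriv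
  constructor
  · rw [iteratedDeriv_one, hd]; simp
  · rw [iteratedDeriv_succ, iteratedDeriv_one, hd]
    have h1 : HasDerivAt (fun z : ℂ => A * (Complex.exp (l * z) * (l * 1)))
        (A * (Complex.exp (l * 0) * (l * 1) * (l * 1))) 0 :=
      ((((hasDerivAt_id (0 : ℂ)).const_mul (l : ℂ)).cexp).mul_const _).const_mul _
    rw [h1.deriv, mul_zero, Complex.exp_zero]
    ring

end

/-- The log ratio lies within `O(r^(l+1))` of the model `a r^l (e^{lz} - 1)` on a fixed disc.
Cauchy's estimates transfer this to the first two derivatives at 0, which for the model are `a l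
r^l` and `a l² r^l`. -/
theorem logRatio_bounds {F : PowerSeries ℝ} {x : ℝ} (h0 : PowerSeries.coeff 0 F = 1)
    (hl : 0 < minExp F) (ha : 0 < PowerSeries.coeff (minExp F) F) (hx : 0 < x)
    (h : Summable fun i => |PowerSeries.coeff i F| * x ^ i) :
    ∃ r₀ c C B : ℝ, 0 < r₀ ∧ r₀ < x ∧ r₀ ≤ 1 ∧ 0 < c ∧ 0 < C ∧ 0 < B ∧
      ∀ r : ℝ, 0 < r → r ≤ r₀ →
        1 / 2 ≤ evalR F r ∧
        c * r ^ minExp F ≤ mu F r ∧ mu F r ≤ C * r ^ minExp F ∧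
        c * r ^ minExp F ≤ sigma F r ∧ sigma F r ≤ C * r ^ minExp F ∧
        iteratedDeriv 1 (logRatio F r) 0 = mu F r ∧
        iteratedDeriv 2 (logRatio F r) 0 = sigma F r ∧
        (∀ z : ℂ, ‖z‖ ≤ 1 → evalC F ((r : ℂ) * Complex.exp z) ≠ 0 ∧
          DifferentiableAt ℂ (logRatio F r) z) ∧
        ∀ z : ℂ, ‖z‖ ≤ 1 / 2 → ‖logRatio F r z‖ ≤ B * r ^ minExp F := by
  set l := minExp F with hldef
  set a := PowerSeries.coeff l F with hadef
  obtain ⟨y, K, hy0, hyx, hy1, hK, H⟩ := log_evalC_near_zero h0 hl hx h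
  -- constants
  set K1 := K * (3 ^ (l + 1) + 1) with hK1
  have hK1n : 0 ≤ K1 := by positivity
  set B := a * (3 ^ l + 1) + K1 with hB
  have hBp : 0 < B := by positivity
  have hl1 : (1 : ℝ) ≤ l := by exact_mod_cast hl
  -- The first entry keeps `|r e^z| ≤ 3r` below `y`; the second makes the largest error `8 K1
  -- r^(l+1)` at most half of `a r^l`.
  set r₀ := min (y / 4) (a / (16 * (K1 + 1))) with hr₀
  have hr₀p : 0 < r₀ := by positivity
  refine ⟨r₀, a / 2, 2 * a * l ^ 2, B, hr₀p, ?_, ?_, by positivity, by positivity, hBp,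
    fun r hr hrr => ?_⟩
  · linarith [min_le_left (y / 4) (a / (16 * (K1 + 1)))]
  · linarith [min_le_left (y / 4) (a / (16 * (K1 + 1)))]
  have hry : r ≤ y / 4 := hrr.trans (min_le_left _ _)
  have hr1 : r ≤ 1 := by linarith
  have hrK : r * (16 * (K1 + 1)) ≤ a := by
    have := hrr.trans (min_le_right _ _)
    rwa [le_div_iff₀ (by positivity)] at this
  have hnorm : ∀ z : ℂ, ‖z‖ ≤ 1 → ‖(r : ℂ) * Complex.exp z‖ ≤ 3 * r := by
    intro z hz
    rw [norm_mul, Complex.norm_real, Real.norm_of_nonneg hr.le, Complex.norm_exp, mul_comm]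
    have h1 : z.re ≤ 1 := (Complex.re_le_norm z).trans hz
    have : Real.exp z.re ≤ 3 := (Real.exp_le_exp.2 h1).trans (by
      linarith [Real.exp_one_lt_d9])
    gcongr
  have hny : ∀ z : ℂ, ‖z‖ ≤ 1 → ‖(r : ℂ) * Complex.exp z‖ ≤ y := fun z hz => by
    linarith [hnorm z hz]
  have hrn : ‖(r : ℂ)‖ = r := by simp [hr.le]
  have hfr : 1 / 2 ≤ evalR F r := by
    have := half_le_re_of_norm_sub_one_le (H r (by rw [hrn]; linarith)).1
    rwa [evalC_ofReal, Complex.ofReal_re] at this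
  have hfz : ∀ z : ℂ, ‖z‖ ≤ 1 → 1 / 2 ≤ (evalC F ((r : ℂ) * Complex.exp z)).re := fun z hz =>
    half_le_re_of_norm_sub_one_le (H _ (hny z hz)).1
  have hfz0 : ∀ z : ℂ, ‖z‖ ≤ 1 → evalC F ((r : ℂ) * Complex.exp z) ≠ 0 := fun z hz h => by
    have := hfz z hz
    rw [h] at this
    simp at this; linarith
  set G := logRatio F r with hG
  have hGd : ∀ z : ℂ, ‖z‖ ≤ 1 → HasDerivAt G (muC F ((r : ℂ) * Complex.exp z)) z := fun z hz =>
    hasDerivAt_logRatio h (by linarith [hny z hz]) (by linarith) (by linarith [hfz z hz])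
  have hball : Metric.ball (0 : ℂ) (2 * (1 / 2)) ∈ 𝓝 (0 : ℂ) :=
    Metric.ball_mem_nhds _ (by norm_num)
  have hGdiff : DifferentiableOn ℂ G (Metric.ball 0 (2 * (1 / 2))) := fun z hz =>
    (hGd z (by rw [mem_ball_zero_iff] at hz; linarith)).differentiableAt.differentiableWithinAt
  have hGexp : ∀ z : ℂ, ‖z‖ ≤ 1 →
      ‖G z - a * r ^ l * (Complex.exp (l * z) - 1)‖ ≤ K1 * r ^ (l + 1) := by
    intro z hz
    rw [hG, logRatio_eq (by linarith) (hfz0 z hz)]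
    have e1 := (H _ (hny z hz)).2
    have e2 := (H r (by rw [hrn]; linarith)).2
    rw [hrn] at e2
    have e3 : ‖(r : ℂ) * Complex.exp z‖ ^ (l + 1) ≤ (3 * r) ^ (l + 1) := by
      gcongr; exact hnorm z hz
    calc _ = ‖(Complex.log (evalC F (r * Complex.exp z)) - a * (r * Complex.exp z) ^ l) -
          (Complex.log (evalC F r) - a * (r : ℂ) ^ l)‖ := by
            rw [mul_pow, ← Complex.exp_nat_mul]; congr 1; ring
      _ ≤ K * (3 * r) ^ (l + 1) + K * r ^ (l + 1) :=
          (norm_sub_le _ _).trans (add_le_add (e1.trans (by gcongr)) e2)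
      _ = _ := by rw [hK1, mul_pow]; ring
  obtain ⟨hG1, hG2⟩ := iteratedDeriv_logRatio h hr (by linarith) (by linarith)
    (by filter_upwards [hball] with z hz
        exact hGd z (by rw [mem_ball_zero_iff] at hz; linarith))
  set E : ℂ → ℂ := fun z => a * r ^ l * (Complex.exp (l * z) - 1) with hE
  obtain ⟨hE1, hE2⟩ : iteratedDeriv 1 E 0 = a * r ^ l * l ∧ iteratedDeriv 2 E 0 = a * r ^ l * l ^ 2 :=
    iteratedDeriv_mul_exp_sub_one _ l
  have hEd : Differentiable ℂ E := by intro z; simp only [hE]; fun_prop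
  have hrl : 0 < r ^ l := by positivity
  have hdiff : ∀ m : ℕ, iteratedDeriv m (fun z => G z - E z) 0 =
      iteratedDeriv m G 0 - iteratedDeriv m E 0 := fun m =>
    iteratedDeriv_fun_sub ((hGdiff.analyticAt hball).contDiffAt)
      ((hEd.analyticAt 0).contDiffAt)
  have hcoef := norm_iteratedDeriv_div_factorial_le (h := fun z => G z - E z) (ρ := 1 / 2)
    (B := K1 * r ^ (l + 1)) (by norm_num) (hGdiff.sub hEd.differentiableOn)
    (fun z hz => hGexp z (by linarith))
  have hμ : |mu F r - a * r ^ l * l| ≤ 2 * K1 * r ^ (l + 1) := by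
    have := hcoef 1
    rw [hdiff, hG, hG1, hE1] at this
    rw [show ((mu F r : ℂ) - a * r ^ l * l) / ((Nat.factorial 1 : ℕ) : ℂ) =
      ((mu F r - a * r ^ l * l : ℝ) : ℂ) by push_cast; simp, Complex.norm_real,
      Real.norm_eq_abs] at this
    refine this.trans (le_of_eq ?_); ring
  have hσ : |sigma F r - a * r ^ l * l ^ 2| ≤ 8 * K1 * r ^ (l + 1) := by
    have := hcoef 2
    rw [hdiff, hG, hG2, hE2] at this
    rw [show ((sigma F r : ℂ) - a * r ^ l * l ^ 2) / ((Nat.factorial 2 : ℕ) : ℂ) =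
      (((sigma F r - a * r ^ l * l ^ 2) / 2 : ℝ) : ℂ) by push_cast; simp [Nat.factorial],
      Complex.norm_real, Real.norm_eq_abs, abs_div, abs_two, div_le_iff₀ (by norm_num)] at this
    refine this.trans (le_of_eq ?_); ring
  have hsmall : 8 * K1 * r ^ (l + 1) ≤ a / 2 * r ^ l := by
    rw [pow_succ]
    nlinarith
  rw [abs_le] at hμ hσ
  have hall : a * r ^ l ≤ a * r ^ l * l := le_mul_of_one_le_right (by positivity) hl1
  have hall2 : a * r ^ l * l ≤ a * r ^ l * l ^ 2 := by
    have : (l : ℝ) ≤ l ^ 2 := by nlinarith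
    gcongr
  have hKr : 0 ≤ K1 * r ^ (l + 1) := by positivity
  have harl : 0 < a * r ^ l := by positivity
  have hσlow : a / 2 * r ^ l ≤ sigma F r := by nlinarith
  refine ⟨hfr, by nlinarith, by nlinarith, hσlow, by nlinarith, hG1, hG2,
    fun z hz => ⟨hfz0 z hz, (hGd z hz).differentiableAt⟩, ?_⟩
  · intro z hz
    have e1 := hGexp z (by linarith)
    have e2 : ‖E z‖ ≤ a * (3 ^ l + 1) * r ^ l := by
      have : E z = a * ((r * Complex.exp z) ^ l - r ^ l) := by
        simp only [hE]; rw [mul_pow, ← Complex.exp_nat_mul]; ring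
      rw [this, norm_mul, Complex.norm_real, Real.norm_of_nonneg ha.le]
      have : ‖((r : ℂ) * Complex.exp z) ^ l - (r : ℂ) ^ l‖ ≤ (3 * r) ^ l + r ^ l := by
        refine (norm_sub_le _ _).trans ?_
        rw [norm_pow, norm_pow, hrn]
        gcongr
        exact hnorm z (by linarith)
      calc _ ≤ a * ((3 * r) ^ l + r ^ l) := by gcongr
        _ = _ := by rw [mul_pow]; ring
    have e3 : K1 * r ^ (l + 1) ≤ K1 * r ^ l := by
      rw [pow_succ]
      exact mul_le_mul_of_nonneg_left (mul_le_of_le_one_right hrl.le hr1) hK1n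
    calc ‖G z‖ = ‖(G z - E z) + E z‖ := by rw [sub_add_cancel]
      _ ≤ K1 * r ^ (l + 1) + a * (3 ^ l + 1) * r ^ l :=
          (norm_add_le _ _).trans (add_le_add e1 e2)
      _ ≤ _ := by rw [hB]; linarith
-- The third order Taylor remainder of the log ratio is `O(r^l |z|³)`, while the divisor `σz²/2` is
-- at least of order `r^l |z|²`. The powers of `r` cancel, so `|φ - 1| ≤ Q|z|` with `Q` independent
-- of `r`.
theorem local_expansion {F : PowerSeries ℝ} {x : ℝ} (h0 : PowerSeries.coeff 0 F = 1)
    (hl : 0 < minExp F) (ha : 0 < PowerSeries.coeff (minExp F) F) (hx : 0 < x)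
    (h : Summable fun i => |PowerSeries.coeff i F| * x ^ i) :
    ∃ r₀ ρ c C : ℝ, 0 < r₀ ∧ r₀ < x ∧ r₀ ≤ 1 ∧ 0 < ρ ∧ ρ ≤ 1 ∧ 0 < c ∧ 0 < C ∧
      ∀ r : ℝ, 0 < r → r ≤ r₀ →
        1 / 2 ≤ evalR F r ∧
        c * r ^ minExp F ≤ mu F r ∧ mu F r ≤ C * r ^ minExp F ∧
        c * r ^ minExp F ≤ sigma F r ∧ sigma F r ≤ C * r ^ minExp F ∧
        DifferentiableOn ℂ (phi F r) (Metric.ball 0 (2 * ρ)) ∧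
        (∀ z ∈ Metric.ball (0 : ℂ) (2 * ρ), 1 / 2 ≤ (phi F r z).re) ∧
        ∀ z ∈ Metric.ball (0 : ℂ) (2 * ρ), evalC F ((r : ℂ) * Complex.exp z) =
          evalR F r * Complex.exp (mu F r * z + 1 / 2 * sigma F r * z ^ 2 * phi F r z) := by
  set l := minExp F with hldef
  obtain ⟨r₀, c, C, B, hr₀, hr₀x, hr₀1, hc, hC, hBp, H⟩ := logRatio_bounds h0 hl ha hx h
  -- The remainder is `2 B r^l (2|z|)³`, and the divisor is at least `c r^l |z|² / 2`.
  set Q := 32 * B / c with hQ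
  have hQp : 0 < Q := by positivity
  set ρ := min (1 / 8 : ℝ) (1 / (4 * Q)) with hρ
  refine ⟨r₀, ρ, c, C, hr₀, hr₀x, hr₀1, by positivity, ?_, hc, hC, fun r hr hrr => ?_⟩
  · linarith [min_le_left (1 / 8 : ℝ) (1 / (4 * Q))]
  obtain ⟨hfr, hμ1, hμ2, hσ1, hσ2, hG1, hG2, hGz, hGB⟩ := H r hr hrr
  set G := logRatio F r with hG
  have hGdiff : DifferentiableOn ℂ G (Metric.ball 0 (2 * (1 / 2))) := fun z hz =>
    (hGz z (by rw [mem_ball_zero_iff] at hz; linarith)).2.differentiableWithinAt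
  have hσ0 : 0 < sigma F r := lt_of_lt_of_le (by positivity) hσ1
  have hσc : (sigma F r : ℂ) ≠ 0 := Complex.ofReal_ne_zero.2 hσ0.ne'
  have hG0 : G 0 = 0 := by
    simp only [hG, logRatio, Complex.exp_zero, mul_one, evalC_ofReal]
    rw [div_self (Complex.ofReal_ne_zero.2 (by linarith)), Complex.log_one]
  have hphi_eq : ∀ z : ℂ, z ≠ 0 →
      phi F r z = (G z - mu F r * z) / (1 / 2 * sigma F r * z ^ 2) := fun z hz => by
    rw [phi, if_neg hz]; rfl
  have hphiB : ∀ z : ℂ, ‖z‖ ≤ 1 / 4 → ‖phi F r z - 1‖ ≤ Q * ‖z‖ := by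
    intro z hz
    by_cases hz0 : z = 0
    · simp [hz0, phi]
    have ht := norm_sub_taylor_le (by norm_num) hGdiff hGB 3 (z := z) (by linarith)
    rw [Finset.sum_range_succ, Finset.sum_range_succ, Finset.sum_range_one, hG1, hG2,
      iteratedDeriv_zero, hG0] at ht
    have e : phi F r z - 1 = (G z - (0 / ((Nat.factorial 0 : ℕ) : ℂ) * z ^ 0 +
        mu F r / ((Nat.factorial 1 : ℕ) : ℂ) * z ^ 1 + sigma F r / ((Nat.factorial 2 : ℕ) : ℂ) * z ^ 2)) /
        (1 / 2 * sigma F r * z ^ 2) := by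
      rw [hphi_eq z hz0]
      simp only [Nat.factorial]
      push_cast
      field_simp
      ring
    have hz' : 0 < ‖z‖ := norm_pos_iff.2 hz0
    rw [e, norm_div]
    have hden : ‖(1 / 2 * sigma F r * z ^ 2 : ℂ)‖ = 1 / 2 * sigma F r * ‖z‖ ^ 2 := by
      simp [abs_of_pos hσ0]
    rw [hden, div_le_iff₀ (by positivity)]
    refine ht.trans ?_
    calc 2 * (B * r ^ l) * (‖z‖ / (1 / 2)) ^ 3 = Q * ‖z‖ * (1 / 2 * (c * r ^ l) * ‖z‖ ^ 2) := by
          rw [hQ]; field_simp; ring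
      _ ≤ _ := by gcongr
  have hρ1 : 2 * ρ ≤ 1 / 4 := by linarith [min_le_left (1 / 8 : ℝ) (1 / (4 * Q))]
  have hρ2 : Q * (2 * ρ) ≤ 1 / 2 := by
    have := min_le_right (1 / 8 : ℝ) (1 / (4 * Q))
    rw [← hρ, le_div_iff₀ (by positivity)] at this
    linarith
  have hρ0 : 0 < ρ := by positivity
  have hpd : ∀ z : ℂ, z ∈ Metric.ball (0 : ℂ) (2 * ρ) → z ≠ 0 →
      DifferentiableAt ℂ (phi F r) z := by
    intro z hz hz0
    rw [mem_ball_zero_iff] at hz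
    have h1 : DifferentiableAt ℂ (fun z => (G z - mu F r * z) / (1 / 2 * sigma F r * z ^ 2)) z := by
      refine DifferentiableAt.div ((hGz z (by linarith)).2.sub (by fun_prop))
        (by fun_prop) ?_
      exact mul_ne_zero (mul_ne_zero (by norm_num) hσc) (pow_ne_zero _ hz0)
    refine h1.congr_of_eventuallyEq ?_
    filter_upwards [isOpen_ne.mem_nhds hz0] with w hw using hphi_eq w hw
  refine ⟨hfr, hμ1, hμ2, hσ1, hσ2, ?_, ?_, ?_⟩
  · intro z hz
    by_cases hz0 : z = 0
    · subst hz0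
      -- The singularity at 0 is removable: `|φ - 1| ≤ Q|z|` gives continuity with the assigned
      -- value 1.
      refine (Complex.analyticAt_of_differentiable_on_punctured_nhds_of_continuousAt ?_ ?_
        ).differentiableAt.differentiableWithinAt
      · filter_upwards [self_mem_nhdsWithin, nhdsWithin_le_nhds
          (Metric.ball_mem_nhds (0 : ℂ) (by linarith : 0 < 2 * ρ))] with w hw1 hw2
        exact hpd w hw2 hw1
      · rw [ContinuousAt, show phi F r 0 = 1 by simp [phi], tendsto_iff_norm_sub_tendsto_zero]
        refine squeeze_zero' (g := fun z => Q * ‖z‖) (.of_forall fun _ => norm_nonneg _) ?_ ?_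
        · filter_upwards [Metric.ball_mem_nhds (0 : ℂ) (by norm_num : (0 : ℝ) < 1 / 4)] with w hw
          exact hphiB w (mem_ball_zero_iff.1 hw).le
        · have : Continuous fun z : ℂ => Q * ‖z‖ := by fun_prop
          simpa using this.tendsto 0
    · exact (hpd z hz hz0).differentiableWithinAt
  · intro z hz
    rw [mem_ball_zero_iff] at hz
    refine half_le_re_of_norm_sub_one_le ((hphiB z (by linarith)).trans ?_)
    nlinarith
  · intro z hz
    rw [mem_ball_zero_iff] at hz
    have hzz : G z = mu F r * z + 1 / 2 * sigma F r * z ^ 2 * phi F r z := by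
      by_cases hz0 : z = 0
      · simp [hz0, hG0]
      · rw [hphi_eq z hz0]; field_simp; ring
    have hfr' : (evalR F r : ℂ) ≠ 0 := Complex.ofReal_ne_zero.2 (by linarith)
    rw [← hzz, hG, logRatio, Complex.exp_log (div_ne_zero ((hGz z (by linarith)).1) hfr')]
    field_simp

/-! ### Decay of `f` on the circle away from the positive axis. -/

section

variable {F : PowerSeries ℝ} {x : ℝ}

theorem StronglyPositiveAt.norm_lt {r : ℝ} (h : StronglyPositiveAt F r) {ζ : ℂ} (hζ : ‖ζ‖ = 1)
    (h1 : ζ ≠ 1) : ‖evalC F (r * ζ)‖ < evalR F r := by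
  have hexp : Complex.exp (Complex.I * (Complex.arg ζ : ℂ)) = ζ := by
    have := Complex.norm_mul_exp_arg_mul_I ζ
    rwa [hζ, Complex.ofReal_one, one_mul, mul_comm] at this
  have hpi := Real.pi_pos
  rcases lt_trichotomy (Complex.arg ζ) 0 with hlt | heq | hgt
  · have := h.2.2 (Complex.arg ζ + 2 * Real.pi) (by linarith [Complex.neg_pi_lt_arg ζ])
      (by linarith)
    have e : Complex.exp (Complex.I * ((Complex.arg ζ + 2 * Real.pi : ℝ) : ℂ)) = ζ := by
      rw [show Complex.I * ((Complex.arg ζ + 2 * Real.pi : ℝ) : ℂ) =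
        Complex.I * (Complex.arg ζ : ℂ) + 2 * Real.pi * Complex.I by push_cast; ring,
        Complex.exp_add, hexp, Complex.exp_two_pi_mul_I, mul_one]
    rwa [e] at this
  · rw [heq] at hexp
    simp at hexp
    exact absurd hexp.symm h1
  · have := h.2.2 (Complex.arg ζ) hgt (by linarith [Complex.arg_le_pi ζ])
    rwa [hexp] at this

theorem re_lt_one_of_norm_eq_one {ζ : ℂ} (hζ : ‖ζ‖ = 1) (h1 : ζ ≠ 1) : ζ.re < 1 := by
  refine lt_of_le_of_ne (hζ ▸ Complex.re_le_norm ζ) fun h => h1 ?_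
  have h2 : ζ.re = ‖ζ‖ := by rw [h, hζ]
  have h3 := Complex.re_eq_norm.1 h2
  rw [Complex.eq_coe_norm_of_nonneg h3, hζ, Complex.ofReal_one]

/-- The terms below `p` agree at `r` and `rζ`, so `Re (f(rζ) - f(r))` is `a r^p (Re ζ^p - 1) +
O(r^(p+1))`. With `a < 0` this would be positive for small `r`, against strong positivity. -/
theorem coeff_pos_of_first_nontrivial (hx : 0 < x)
    (h : Summable fun i => |PowerSeries.coeff i F| * x ^ i)
    (hpos : ∀ᶠ r : ℝ in 𝓝[>] 0, StronglyPositiveAt F r) {ζ : ℂ} (hζ : ‖ζ‖ = 1) {p : ℕ}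
    (hp : PowerSeries.coeff p F ≠ 0) (hζp : ζ ^ p ≠ 1)
    (hinv : ∀ i < p, PowerSeries.coeff i F ≠ 0 → ζ ^ i = 1) : 0 < PowerSeries.coeff p F := by
  by_contra hneg
  have hlt : PowerSeries.coeff p F < 0 := lt_of_le_of_ne (not_lt.1 hneg) hp
  set a := PowerSeries.coeff p F with ha
  have hζ1 : ζ ≠ 1 := by rintro rfl; simp at hζp
  have hre : (ζ ^ p).re < 1 := re_lt_one_of_norm_eq_one (by simp [hζ]) hζp
  obtain ⟨C, hC, H⟩ := norm_evalC_sub_sum_le hx h (p + 1)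
  set κ := -a * (1 - (ζ ^ p).re) with hκ
  have hκ0 : 0 < κ := mul_pos (by linarith) (by linarith)
  have hev : ∀ᶠ r : ℝ in 𝓝[>] 0, r < min x (κ / (2 * C + 1)) :=
    nhdsWithin_le_nhds (Iio_mem_nhds (by positivity))
  obtain ⟨r, hsp, hr, hrpos⟩ := (hpos.and (hev.and self_mem_nhdsWithin)).exists
  have hr0 : 0 < r := hrpos
  have hrx : r ≤ x := hr.le.trans (min_le_left _ _)
  have hrκ : r * (2 * C + 1) < κ := by
    have := hr.trans_le (min_le_right _ _)
    rwa [lt_div_iff₀ (by positivity)] at this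
  have hn1 : ‖(r : ℂ)‖ = r := by simp [hr0.le]
  have hn2 : ‖(r : ℂ) * ζ‖ = r := by rw [norm_mul, hn1, hζ, mul_one]
  have e1 := H r (by rw [hn1]; exact hrx)
  have e2 := H (r * ζ) (by rw [hn2]; exact hrx)
  rw [hn1] at e1
  rw [hn2] at e2
  have hs : ∑ i ∈ Finset.range (p + 1), ((PowerSeries.coeff i F : ℝ) : ℂ) * (r * ζ) ^ i =
      ∑ i ∈ Finset.range (p + 1), ((PowerSeries.coeff i F : ℝ) : ℂ) * (r : ℂ) ^ i +
        a * r ^ p * (ζ ^ p - 1) := by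
    rw [Finset.sum_range_succ, Finset.sum_range_succ]
    have : ∑ i ∈ Finset.range p, ((PowerSeries.coeff i F : ℝ) : ℂ) * (r * ζ) ^ i =
        ∑ i ∈ Finset.range p, ((PowerSeries.coeff i F : ℝ) : ℂ) * (r : ℂ) ^ i := by
      refine Finset.sum_congr rfl fun i hi => ?_
      by_cases hi0 : PowerSeries.coeff i F = 0
      · simp [hi0]
      · rw [mul_pow, hinv i (Finset.mem_range.1 hi) hi0, mul_one]
    rw [this, mul_pow]; ring
  rw [hs] at e2
  set T := ∑ i ∈ Finset.range (p + 1), ((PowerSeries.coeff i F : ℝ) : ℂ) * (r : ℂ) ^ i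
  have e3 : ‖evalC F (r * ζ) - evalC F r - a * r ^ p * (ζ ^ p - 1)‖ ≤ 2 * C * r ^ (p + 1) := by
    calc _ = ‖(evalC F (r * ζ) - (T + a * r ^ p * (ζ ^ p - 1))) - (evalC F r - T)‖ := by
          congr 1; ring
      _ ≤ C * r ^ (p + 1) + C * r ^ (p + 1) := (norm_sub_le _ _).trans (add_le_add e2 e1)
      _ = _ := by ring
  have e4 := (Complex.abs_re_le_norm _).trans e3
  have e5 : ((a : ℂ) * r ^ p * (ζ ^ p - 1)).re = κ * r ^ p := by
    rw [show (a : ℂ) * r ^ p = ((a * r ^ p : ℝ) : ℂ) by push_cast; rfl, Complex.re_ofReal_mul,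
      Complex.sub_re, Complex.one_re, hκ]
    ring
  rw [Complex.sub_re, Complex.sub_re, e5, evalC_ofReal, Complex.ofReal_re, abs_le] at e4
  have e6 := (Complex.re_le_norm _).trans_lt (hsp.norm_lt hζ hζ1)
  have hrp : 0 < r ^ p := by positivity
  have e7 : κ * r ^ p < 2 * C * r ^ (p + 1) := by linarith [e4.1]
  rw [pow_succ] at e7
  nlinarith

/-- Controls the terms below `p` when the angle moves by `t` from one where they are all fixed. The
`l` term makes the real part at most a negative multiple of `r^l t²`; exponents above `l` contribute
`O(r^(l+1) t²)` whatever their signs, and the squared modulus is only `O(r^(2l) t²)`. -/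
theorem rotation_sum_bound (hl : 0 < minExp F) (ha : 0 < PowerSeries.coeff (minExp F) F) (p : ℕ) :
    ∃ r₁ t₁ : ℝ, 0 < r₁ ∧ 0 < t₁ ∧ ∀ r t : ℝ, 0 < r → r ≤ r₁ → |t| ≤ t₁ →
      2 * ‖∑ i ∈ Finset.range p, ((PowerSeries.coeff i F * r ^ i : ℝ) : ℂ) *
        (Complex.exp (Complex.I * ((i * t : ℝ) : ℂ)) - 1)‖ ^ 2 ≤
      -(∑ i ∈ Finset.range p, ((PowerSeries.coeff i F * r ^ i : ℝ) : ℂ) *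
        (Complex.exp (Complex.I * ((i * t : ℝ) : ℂ)) - 1)).re := by
  set l := minExp F with hldef
  have hvan : ∀ i < l, ∀ r t : ℝ, ((PowerSeries.coeff i F * r ^ i : ℝ) : ℂ) *
        (Complex.exp (Complex.I * ((i * t : ℝ) : ℂ)) - 1) = 0 := by
    intro i hi r t
    rcases Nat.eq_zero_or_pos i with rfl | h0
    · simp
    · rw [coeff_eq_zero_of_lt_minExp h0 hi]; simp
  by_cases hpl : p ≤ l
  · refine ⟨1, 1, one_pos, one_pos, fun r t _ _ _ => ?_⟩
    rw [Finset.sum_eq_zero fun i hi => hvan i ((Finset.mem_range.1 hi).trans_le hpl) r t]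
    simp
  push Not at hpl
  set a := PowerSeries.coeff l F with hadef
  set S := ∑ i ∈ Finset.range p, |PowerSeries.coeff i F| * i ^ 2 / 2 with hS
  set S' := ∑ i ∈ Finset.range p, |PowerSeries.coeff i F| * i with hS'
  have hS0 : 0 ≤ S := Finset.sum_nonneg fun i _ => by positivity
  have hS'0 : 0 ≤ S' := Finset.sum_nonneg fun i _ => by positivity
  have hl0 : (0 : ℝ) < l := by exact_mod_cast hl
  set κ := a * l ^ 2 / 4 with hκ
  have hκ0 : 0 < κ := by positivity
  refine ⟨min 1 (κ / (S + 2 * S' ^ 2 + 1)), 1 / l, by positivity, by positivity,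
    fun r t hr hrr ht => ?_⟩
  have hr1 : r ≤ 1 := hrr.trans (min_le_left _ _)
  have hrκ : r * (S + 2 * S' ^ 2 + 1) ≤ κ := by
    have := hrr.trans (min_le_right _ _)
    rwa [le_div_iff₀ (by positivity)] at this
  have hlt : |l * t| ≤ 1 := by
    rw [abs_mul, abs_of_pos hl0]
    rw [le_div_iff₀ hl0] at ht; linarith
  have hre : ∀ i : ℕ, (((PowerSeries.coeff i F * r ^ i : ℝ) : ℂ) *
      (Complex.exp (Complex.I * ((i * t : ℝ) : ℂ)) - 1)).re =
      PowerSeries.coeff i F * r ^ i * (Real.cos (i * t) - 1) := by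
    intro i
    rw [Complex.re_ofReal_mul, Complex.sub_re, Complex.one_re, mul_comm Complex.I,
      Complex.exp_ofReal_mul_I_re]
  have hnorm : ‖∑ i ∈ Finset.range p, ((PowerSeries.coeff i F * r ^ i : ℝ) : ℂ) *
        (Complex.exp (Complex.I * ((i * t : ℝ) : ℂ)) - 1)‖ ≤ S' * (r ^ l * |t|) := by
    rw [hS', Finset.sum_mul]
    refine norm_sum_le_of_le _ fun i _ => ?_
    by_cases hil : i < l
    · rw [hvan i hil, norm_zero]; positivity
    · have h1 := Real.norm_exp_I_mul_ofReal_sub_one_le (x := i * t)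
      rw [Real.norm_eq_abs, abs_mul, Nat.abs_cast] at h1
      have h2 : r ^ i ≤ r ^ l := pow_le_pow_of_le_one hr.le hr1 (not_lt.1 hil)
      rw [norm_mul, Complex.norm_real, Real.norm_eq_abs, abs_mul, abs_of_pos (pow_pos hr i)]
      calc _ ≤ |PowerSeries.coeff i F| * r ^ l * (i * |t|) := by gcongr
        _ = _ := by ring
  have hsum : κ * (r ^ l * t ^ 2) - S * (r ^ (l + 1) * t ^ 2) ≤
      -(∑ i ∈ Finset.range p, ((PowerSeries.coeff i F * r ^ i : ℝ) : ℂ) *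
        (Complex.exp (Complex.I * ((i * t : ℝ) : ℂ)) - 1)).re := by
    rw [Complex.re_sum, ← Finset.sum_neg_distrib, hS, Finset.sum_mul, sub_le_iff_le_add,
      ← Finset.sum_add_distrib]
    -- After adding the correction `S`, every term with `i ≠ l` is nonnegative, so the whole sum is
    -- at least its `l` term.
    have hterm : ∀ i ∈ Finset.range p, 0 ≤ -(((PowerSeries.coeff i F * r ^ i : ℝ) : ℂ) *
        (Complex.exp (Complex.I * ((i * t : ℝ) : ℂ)) - 1)).re +
        |PowerSeries.coeff i F| * i ^ 2 / 2 * (r ^ (l + 1) * t ^ 2) ∨ i = l := by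
      intro i _
      rcases lt_trichotomy i l with hil | hil | hil
      · left; rw [hvan i hil]; simp; positivity
      · right; exact hil
      · left
        rw [hre]
        have h1 : 1 - Real.cos (i * t) ≤ i ^ 2 * t ^ 2 / 2 := by
          have := Real.one_sub_sq_div_two_le_cos (x := i * t)
          rw [mul_pow] at this; linarith
        have h1' : 0 ≤ 1 - Real.cos (i * t) := by linarith [Real.cos_le_one (i * t)]
        have h2 : r ^ i ≤ r ^ (l + 1) := pow_le_pow_of_le_one hr.le hr1 hil
        have h3 : |PowerSeries.coeff i F| * (r ^ i * (1 - Real.cos (i * t))) ≤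
            |PowerSeries.coeff i F| * (r ^ (l + 1) * (i ^ 2 * t ^ 2 / 2)) := by gcongr
        have h4 : -|PowerSeries.coeff i F| * (r ^ i * (1 - Real.cos (i * t))) ≤
            PowerSeries.coeff i F * (r ^ i * (1 - Real.cos (i * t))) :=
          mul_le_mul_of_nonneg_right (neg_abs_le _) (by positivity)
        nlinarith
    have hlterm : κ * (r ^ l * t ^ 2) ≤ -(((PowerSeries.coeff l F * r ^ l : ℝ) : ℂ) *
        (Complex.exp (Complex.I * ((l * t : ℝ) : ℂ)) - 1)).re := by
      rw [hre]
      have h1 : Real.cos (l * t) ≤ 1 - (l * t) ^ 2 / 4 := by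
        have h2 := (abs_le.1 (Real.cos_bound hlt)).2
        have h3 : |l * t| ^ 4 ≤ (l * t) ^ 2 := by
          rw [← sq_abs (l * t)]
          exact pow_le_pow_of_le_one (abs_nonneg _) hlt (by norm_num)
        nlinarith [sq_nonneg (l * t)]
      have h2 : a * r ^ l * ((l * t) ^ 2 / 4) ≤ a * r ^ l * (1 - Real.cos (l * t)) := by
        gcongr; linarith
      rw [hκ, ← hadef]
      nlinarith
    calc κ * (r ^ l * t ^ 2) ≤ _ := hlterm
      _ ≤ -(((PowerSeries.coeff l F * r ^ l : ℝ) : ℂ) *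
        (Complex.exp (Complex.I * ((l * t : ℝ) : ℂ)) - 1)).re +
        |PowerSeries.coeff l F| * l ^ 2 / 2 * (r ^ (l + 1) * t ^ 2) := by
          have : 0 ≤ |PowerSeries.coeff l F| * l ^ 2 / 2 * (r ^ (l + 1) * t ^ 2) := by positivity
          linarith
      _ ≤ _ := Finset.single_le_sum (f := fun i : ℕ =>
          -(((PowerSeries.coeff i F * r ^ i : ℝ) : ℂ) *
          (Complex.exp (Complex.I * ((i * t : ℝ) : ℂ)) - 1)).re +
          |PowerSeries.coeff i F| * i ^ 2 / 2 * (r ^ (l + 1) * t ^ 2)) (fun i hi => by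
            rcases hterm i hi with h | rfl
            · exact h
            · have : 0 ≤ |PowerSeries.coeff l F| * l ^ 2 / 2 * (r ^ (l + 1) * t ^ 2) := by
                positivity
              have h5 : 0 ≤ κ * (r ^ l * t ^ 2) := by positivity
              linarith) (Finset.mem_range.2 hpl)
  refine le_trans ?_ hsum
  have h1 : ‖∑ i ∈ Finset.range p, ((PowerSeries.coeff i F * r ^ i : ℝ) : ℂ) *
        (Complex.exp (Complex.I * ((i * t : ℝ) : ℂ)) - 1)‖ ^ 2 ≤ (S' * (r ^ l * |t|)) ^ 2 := by
    gcongr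
  have h2 : (S' * (r ^ l * |t|)) ^ 2 ≤ S' ^ 2 * (r * (r ^ l * t ^ 2)) := by
    have : r ^ l ≤ r := pow_le_of_le_one hr.le hr1 hl.ne'
    calc _ = S' ^ 2 * (r ^ l * (r ^ l * t ^ 2)) := by rw [mul_pow, mul_pow, sq_abs]; ring
      _ ≤ _ := by gcongr
  have h3 : 0 ≤ r ^ l * t ^ 2 := by positivity
  rw [pow_succ r]
  have h4 : 0 ≤ r * (r ^ l * t ^ 2) := by positivity
  nlinarith [mul_le_mul_of_nonneg_right hrκ h3]

end

section

variable {F : PowerSeries ℝ} {x : ℝ}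

/-- Expand `|f + D + E|²`: since `2f ≥ 1`, the negative real parts absorb `|D + E|² ≤ 2|D|² + 2|E|²`
and leave `f² - η`. As `f² ≤ 4`, this is at most `f²(1 - η/4) ≤ f² exp(-η/4)`. -/
theorem norm_add_le_mul_exp {f η : ℝ} {D E : ℂ} (hf1 : 1 / 2 ≤ f) (hf2 : f ≤ 3 / 2)
    (hη : 0 ≤ η) (hD : 2 * ‖D‖ ^ 2 ≤ -D.re) (hE : E.re + 2 * ‖E‖ ^ 2 ≤ -η) (hE0 : E.re ≤ 0) :
    ‖(f : ℂ) + (D + E)‖ ≤ f * Real.exp (-(η / 8)) := by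
  have hD0 : D.re ≤ 0 := by linarith [sq_nonneg ‖D‖]
  have h1 : ‖(f : ℂ) + (D + E)‖ ^ 2 = f ^ 2 + 2 * f * (D.re + E.re) + ‖D + E‖ ^ 2 := by
    rw [Complex.sq_norm, Complex.sq_norm, Complex.normSq_apply, Complex.normSq_apply]
    simp; ring
  have h2 : ‖D + E‖ ^ 2 ≤ 2 * ‖D‖ ^ 2 + 2 * ‖E‖ ^ 2 := by
    have : ‖D + E‖ ^ 2 ≤ (‖D‖ + ‖E‖) ^ 2 := by gcongr; exact norm_add_le _ _
    linarith [sq_nonneg (‖D‖ - ‖E‖), add_pow_two ‖D‖ ‖E‖, sub_sq ‖D‖ ‖E‖]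
  have h3 : 2 * f * (D.re + E.re) ≤ 1 * (D.re + E.re) :=
    mul_le_mul_of_nonpos_right (by linarith) (by linarith)
  have h4 : ‖(f : ℂ) + (D + E)‖ ^ 2 ≤ f ^ 2 - η := by linarith
  have hfsq : f ^ 2 ≤ 4 := by nlinarith
  have h5 : f ^ 2 - η ≤ (f * Real.exp (-(η / 8))) ^ 2 := by
    rw [mul_pow, ← Real.exp_nat_mul]
    have h6 : f ^ 2 * (((2 : ℕ) : ℝ) * -(η / 8) + 1) ≤ f ^ 2 * Real.exp (((2 : ℕ) : ℝ) * -(η / 8)) := by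
      gcongr
      exact Real.add_one_le_exp _
    refine le_trans ?_ h6
    push_cast
    nlinarith
  exact le_of_sq_le_sq (h4.trans h5) (by positivity)

/-- With `θ = θ₀ + t`, the terms below `p` feel only `t` and form `D`, which does no harm. The `p`
term forms the main part of `E` and lowers the real part by a multiple of `r^p`, uniformly for `θ`
near `θ₀`. -/
theorem norm_evalC_le_near_of_first_nontrivial (h0 : PowerSeries.coeff 0 F = 1)
    (hl : 0 < minExp F) (ha : 0 < PowerSeries.coeff (minExp F) F) (hx : 0 < x)
    (h : Summable fun i => |PowerSeries.coeff i F| * x ^ i) {θ₀ : ℝ} {p : ℕ}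
    (hp0 : 0 < p) (hp : 0 < PowerSeries.coeff p F)
    (hζp : Complex.exp (Complex.I * θ₀) ^ p ≠ 1)
    (hinv : ∀ i < p, PowerSeries.coeff i F ≠ 0 → Complex.exp (Complex.I * θ₀) ^ i = 1) :
    ∃ t₁ r₁ c : ℝ, 0 < t₁ ∧ 0 < r₁ ∧ r₁ ≤ 1 ∧ 0 < c ∧ ∀ θ r : ℝ, |θ - θ₀| < t₁ → 0 < r → r ≤ r₁ →
      ‖evalC F (r * Complex.exp (Complex.I * θ))‖ ≤ evalR F r * Real.exp (-(c * r ^ p)) := by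
  set a := PowerSeries.coeff p F with hadef
  obtain ⟨y, _, hy0, hyx, hy1, _, Hy⟩ := log_evalC_near_zero h0 hl hx h
  obtain ⟨C, hC, H⟩ := norm_evalC_sub_sum_le hx h (p + 1)
  obtain ⟨r₂, t₂, hr₂, ht₂, HD⟩ := rotation_sum_bound hl ha p
  have hpow : ∀ (θ : ℝ) (i : ℕ), Complex.exp (Complex.I * θ) ^ i =
      Complex.exp (Complex.I * ((i * θ : ℝ) : ℂ)) := by
    intro θ i
    rw [← Complex.exp_nat_mul]; congr 1; push_cast; ring
  have hone : ∀ θ : ℝ, ‖Complex.exp (Complex.I * θ)‖ = 1 := by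
    intro θ; rw [mul_comm]; exact Complex.norm_exp_ofReal_mul_I θ
  have hre : (Complex.exp (Complex.I * θ₀) ^ p).re < 1 :=
    re_lt_one_of_norm_eq_one (by rw [norm_pow, hone, one_pow]) hζp
  set κ := (1 - (Complex.exp (Complex.I * θ₀) ^ p).re) / 2 with hκ
  have hκ0 : 0 < κ := by rw [hκ]; linarith
  have hcont : Continuous fun θ : ℝ => (Complex.exp (Complex.I * θ) ^ p).re :=
    Complex.continuous_re.comp (by fun_prop)
  have hnear : ∀ᶠ θ : ℝ in 𝓝 θ₀, (Complex.exp (Complex.I * θ) ^ p).re < 1 - κ :=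
    (hcont.tendsto θ₀).eventually_lt_const (by rw [hκ]; linarith)
  obtain ⟨t₃, ht₃, Ht₃⟩ := Metric.eventually_nhds_iff.1 hnear
  set W := 2 * (2 * a + 2 * C) ^ 2 + 2 * C + 1 with hW
  have hW0 : 0 < W := by positivity
  refine ⟨min t₂ t₃, min (min y r₂) (a * κ / (2 * W)), a * κ / 16, by positivity,
    by positivity, ((min_le_left _ _).trans (min_le_left _ _)).trans hy1, by positivity,
    fun θ r hθ hr hrr => ?_⟩
  have hry : r ≤ y := hrr.trans ((min_le_left _ _).trans (min_le_left _ _))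
  have hrr₂ : r ≤ r₂ := hrr.trans ((min_le_left _ _).trans (min_le_right _ _))
  have hrW : r * (2 * W) ≤ a * κ := by
    have := hrr.trans (min_le_right _ _)
    rwa [le_div_iff₀ (by positivity)] at this
  have hr1 : r ≤ 1 := hry.trans hy1
  have hn1 : ‖(r : ℂ)‖ = r := by simp [hr.le]
  have hn2 : ‖(r : ℂ) * Complex.exp (Complex.I * θ)‖ = r := by rw [norm_mul, hn1, hone, mul_one]
  set f := evalR F r with hf
  have hf1 : ‖evalC F r - 1‖ ≤ 1 / 2 := (Hy r (by rw [hn1]; exact hry)).1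
  have hfb : |f - 1| ≤ 1 / 2 := by
    rw [evalC_ofReal] at hf1
    rwa [← Real.norm_eq_abs, ← Complex.norm_real, Complex.ofReal_sub]
  rw [abs_le] at hfb
  have e1 := H r (by rw [hn1]; linarith)
  have e2 := H (r * Complex.exp (Complex.I * θ)) (by rw [hn2]; linarith)
  rw [hn1] at e1
  rw [hn2] at e2
  set t := θ - θ₀ with ht
  set D := ∑ i ∈ Finset.range p, ((PowerSeries.coeff i F * r ^ i : ℝ) : ℂ) *
        (Complex.exp (Complex.I * ((i * t : ℝ) : ℂ)) - 1) with hD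
  have hDb := HD r t hr hrr₂ ((hθ.trans_le (min_le_left _ _)).le)
  rw [← hD] at hDb
  set u := Complex.exp (Complex.I * θ) ^ p with hu
  have hu1 : ‖u‖ = 1 := by rw [hu, norm_pow, hone, one_pow]
  have hure : u.re < 1 - κ := Ht₃ (by
    rw [Real.dist_eq]; exact hθ.trans_le (min_le_right _ _))
  set T := ∑ i ∈ Finset.range (p + 1), ((PowerSeries.coeff i F : ℝ) : ℂ) * (r : ℂ) ^ i with hT
  have hs : ∑ i ∈ Finset.range (p + 1), ((PowerSeries.coeff i F : ℝ) : ℂ) *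
      (r * Complex.exp (Complex.I * θ)) ^ i = T + D + ((a * r ^ p : ℝ) : ℂ) * (u - 1) := by
    rw [hT, Finset.sum_range_succ, Finset.sum_range_succ]
    have : ∑ i ∈ Finset.range p, ((PowerSeries.coeff i F : ℝ) : ℂ) *
        (r * Complex.exp (Complex.I * θ)) ^ i =
        ∑ i ∈ Finset.range p, ((PowerSeries.coeff i F : ℝ) : ℂ) * (r : ℂ) ^ i + D := by
      rw [hD, ← Finset.sum_add_distrib]
      refine Finset.sum_congr rfl fun i hi => ?_
      by_cases hi0 : PowerSeries.coeff i F = 0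
      · simp [hi0]
      · have e : Complex.exp (Complex.I * θ) = Complex.exp (Complex.I * θ₀) *
            Complex.exp (Complex.I * (t : ℝ)) := by
          rw [← Complex.exp_add, ht]; congr 1; push_cast; ring
        rw [mul_pow, e, mul_pow, hinv i (Finset.mem_range.1 hi) hi0, hpow]
        push_cast; ring
    rw [this, mul_pow, ← hu, ← hadef]
    push_cast; ring
  rw [hs] at e2
  set E := evalC F (r * Complex.exp (Complex.I * θ)) - f - D with hE
  have e3 : ‖E - ((a * r ^ p : ℝ) : ℂ) * (u - 1)‖ ≤ 2 * C * r ^ (p + 1) := by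
    calc _ = ‖(evalC F (r * Complex.exp (Complex.I * θ)) -
          (T + D + ((a * r ^ p : ℝ) : ℂ) * (u - 1))) - (evalC F r - T)‖ := by
          rw [hE, evalC_ofReal]; congr 1; ring
      _ ≤ C * r ^ (p + 1) + C * r ^ (p + 1) := (norm_sub_le _ _).trans (add_le_add e2 e1)
      _ = _ := by ring
  have hrp : 0 < r ^ p := by positivity
  have hrp1 : r ^ (p + 1) = r ^ p * r := pow_succ _ _
  have hEre : E.re ≤ -(a * κ * r ^ p) + 2 * C * r ^ (p + 1) := by
    have := (abs_le.1 ((Complex.abs_re_le_norm _).trans e3)).2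
    rw [Complex.sub_re E, Complex.re_ofReal_mul, Complex.sub_re u, Complex.one_re] at this
    have h1 : a * r ^ p * (u.re - 1) ≤ a * r ^ p * (-κ) := by gcongr; linarith
    linarith
  have hEn : ‖E‖ ≤ (2 * a + 2 * C) * r ^ p := by
    calc ‖E‖ = ‖(E - ((a * r ^ p : ℝ) : ℂ) * (u - 1)) + ((a * r ^ p : ℝ) : ℂ) * (u - 1)‖ := by
          rw [sub_add_cancel]
      _ ≤ 2 * C * r ^ (p + 1) + a * r ^ p * 2 := by
          refine (norm_add_le _ _).trans (add_le_add e3 ?_)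
          rw [norm_mul, Complex.norm_real, Real.norm_of_nonneg (by positivity)]
          have : ‖u - 1‖ ≤ 2 := (norm_sub_le _ _).trans (by rw [hu1, norm_one]; norm_num)
          gcongr
      _ ≤ 2 * C * r ^ p + a * r ^ p * 2 := by
          have : r ^ (p + 1) ≤ r ^ p := pow_le_pow_of_le_one hr.le hr1 (Nat.le_succ p)
          gcongr
      _ = _ := by ring
  have hEsq : ‖E‖ ^ 2 ≤ (2 * a + 2 * C) ^ 2 * (r * r ^ p) := by
    have h1 : r ^ p ≤ r := pow_le_of_le_one hr.le hr1 hp0.ne'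
    calc ‖E‖ ^ 2 ≤ ((2 * a + 2 * C) * r ^ p) ^ 2 := by gcongr
      _ = (2 * a + 2 * C) ^ 2 * (r ^ p * r ^ p) := by ring
      _ ≤ _ := by gcongr
  have hErp : E.re + 2 * ‖E‖ ^ 2 ≤ -(a * κ / 2 * r ^ p) := by
    have h1 := mul_le_mul_of_nonneg_right hrW hrp.le
    have h2 : 0 ≤ r * r ^ p := by positivity
    rw [hrp1] at hEre
    rw [hW] at h1
    linarith
  have hη : 0 ≤ a * κ / 2 * r ^ p := by positivity
  have hEneg : E.re ≤ 0 := by linarith [sq_nonneg ‖E‖]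
  have e : evalC F (r * Complex.exp (Complex.I * θ)) = (f : ℂ) + (D + E) := by
    rw [hE]; ring
  rw [e]
  refine (norm_add_le_mul_exp (η := a * κ / 2 * r ^ p) (by linarith) (by linarith)
    hη hDb hErp hEneg).trans (le_of_eq ?_)
  congr 3
  ring

theorem expSet_nonempty (hgcd : ∀ d : ℕ, (∀ i ∈ expSet F, d ∣ i) → d = 1) :
    (expSet F).Nonempty := by
  by_contra hne
  rw [Set.not_nonempty_iff_eq_empty] at hne
  have := hgcd 2 (by simp [hne])
  omega

theorem minExp_mem (hgcd : ∀ d : ℕ, (∀ i ∈ expSet F, d ∣ i) → d = 1) : minExp F ∈ expSet F :=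
  Nat.sInf_mem (expSet_nonempty hgcd)

theorem two_le_minExp (h1 : PowerSeries.coeff 1 F = 0)
    (hgcd : ∀ d : ℕ, (∀ i ∈ expSet F, d ∣ i) → d = 1) : 2 ≤ minExp F := by
  have hm := minExp_mem hgcd
  have h2 : minExp F ≠ 1 := fun h => hm.2 (by rw [h]; exact h1)
  have := hm.1
  omega

theorem one_sub_le_eps0 {j : ℕ} (hj : j ∈ Set.Icc 1 (minExp F / 2)) :
    1 - (minExp F : ℝ) / (lExp F j : ℝ) ≤ eps0 F :=
  le_csSup ((Set.finite_Icc _ _).image _).bddAbove (Set.mem_image_of_mem _ hj)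

theorem eps0_nonneg (h1 : PowerSeries.coeff 1 F = 0)
    (hgcd : ∀ d : ℕ, (∀ i ∈ expSet F, d ∣ i) → d = 1) : 0 ≤ eps0 F := by
  have hl := two_le_minExp h1 hgcd
  refine le_trans ?_ (one_sub_le_eps0 (F := F) (j := 1) ⟨le_rfl, by omega⟩)
  rw [sub_nonneg]
  -- For an empty set `lExp` is 0 and the quotient by 0 is 0.
  rcases Set.eq_empty_or_nonempty {i | i ∈ expSet F ∧ ¬ minExp F ∣ 1 * i} with he | hne
  · rw [lExp, he]; simp
  · have hm : lExp F 1 ∈ {i | i ∈ expSet F ∧ ¬ minExp F ∣ 1 * i} := Nat.sInf_mem hne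
    have : minExp F ≤ lExp F 1 := Nat.sInf_le hm.1
    exact div_le_one_of_le₀ (by exact_mod_cast this) (by positivity)

/-- If no exponent moved `ζ`, its order would divide all of `L`, hence be 1. If `ζ^l ≠ 1` then `p ≤
l` and `δ > 0` suffices. Otherwise `ζ = e^{2πij/l}` and `p = l_j`; the symmetry `j ↦ l - j` brings
`j` into the range over which `ε₀` is a maximum. -/
theorem exists_first_nontrivial (h1 : PowerSeries.coeff 1 F = 0)
    (hgcd : ∀ d : ℕ, (∀ i ∈ expSet F, d ∣ i) → d = 1) {δ : ℝ} (hδ : eps0 F < δ)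
    {ζ : ℂ} (hζ : ζ ≠ 1) :
    ∃ p ∈ expSet F, ζ ^ p ≠ 1 ∧ (∀ i < p, PowerSeries.coeff i F ≠ 0 → ζ ^ i = 1) ∧
      (1 - δ) * p < minExp F := by
  set S := {i | i ∈ expSet F ∧ ζ ^ i ≠ 1} with hS
  have hne : S.Nonempty := by
    by_contra hne
    rw [Set.not_nonempty_iff_eq_empty] at hne
    refine hζ (orderOf_eq_one_iff.1 (hgcd _ fun i hi => orderOf_dvd_of_pow_eq_one ?_))
    by_contra hi1
    have : i ∈ S := ⟨hi, hi1⟩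
    simp [hne] at this
  have hmem : sInf S ∈ S := Nat.sInf_mem hne
  have hl := two_le_minExp h1 hgcd
  have hl0 : (0 : ℝ) < minExp F := by exact_mod_cast (by omega : 0 < minExp F)
  have hδ0 : 0 < δ := (eps0_nonneg h1 hgcd).trans_lt hδ
  refine ⟨sInf S, hmem.1, hmem.2, fun i hi hci => ?_, ?_⟩
  · by_contra hi1
    rcases Nat.eq_zero_or_pos i with rfl | h0
    · simp at hi1
    · exact Nat.notMem_of_lt_sInf hi ⟨⟨h0, hci⟩, hi1⟩
  by_cases hζl : ζ ^ minExp F = 1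
  · have : NeZero (minExp F) := ⟨by omega⟩
    have hprim := Complex.isPrimitiveRoot_exp (minExp F) (by omega)
    obtain ⟨j, hj, hjζ⟩ := hprim.eq_pow_of_pow_eq_one hζl
    have hj0 : 0 < j := Nat.pos_of_ne_zero fun h => hζ (by rw [← hjζ, h, pow_zero])
    have hpow : ∀ i, ζ ^ i = 1 ↔ minExp F ∣ j * i := by
      intro i
      rw [← hjζ, ← pow_mul, hprim.pow_eq_one_iff_dvd]
    have hSj : lExp F j = sInf S := by
      rw [lExp, hS]; congr 1; ext i; simp [hpow]
    obtain ⟨j', hj', hjj'⟩ : ∃ j' ∈ Set.Icc 1 (minExp F / 2), lExp F j' = sInf S := by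
      by_cases hjl : j ≤ minExp F / 2
      · exact ⟨j, ⟨hj0, hjl⟩, hSj⟩
      · refine ⟨minExp F - j, ⟨by omega, by omega⟩, ?_⟩
        rw [← hSj, lExp, lExp]
        congr 1; ext i
        have : minExp F ∣ (minExp F - j) * i ↔ minExp F ∣ j * i := by
          have hsum : (minExp F - j) * i + j * i = minExp F * i := by
            rw [← add_mul, Nat.sub_add_cancel hj.le]
          constructor <;> intro hd
          · exact (Nat.dvd_add_right hd).1 (hsum ▸ dvd_mul_right _ _)
          · exact (Nat.dvd_add_left hd).1 (hsum ▸ dvd_mul_right _ _)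
        simp [this]
    have hlt := (one_sub_le_eps0 hj').trans_lt hδ
    rw [hjj'] at hlt
    have hp0 : (0 : ℝ) < (sInf S : ℕ) := by exact_mod_cast hmem.1.1
    have : 1 - δ < (minExp F : ℝ) / (sInf S : ℕ) := by linarith
    rwa [lt_div_iff₀ hp0] at this
  · have : sInf S ≤ minExp F := Nat.sInf_le ⟨minExp_mem hgcd, hζl⟩
    have h2 : ((sInf S : ℕ) : ℝ) ≤ minExp F := by exact_mod_cast this
    have hp0 : (0 : ℝ) < (sInf S : ℕ) := by exact_mod_cast hmem.1.1
    nlinarith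

theorem norm_evalC_le_off_saddle (h0 : PowerSeries.coeff 0 F = 1) (h1 : PowerSeries.coeff 1 F = 0)
    (hgcd : ∀ d : ℕ, (∀ i ∈ expSet F, d ∣ i) → d = 1)
    (hpos : ∀ᶠ r : ℝ in 𝓝[>] 0, StronglyPositiveAt F r)
    (ha : 0 < PowerSeries.coeff (minExp F) F) (hx : 0 < x)
    (h : Summable fun i => |PowerSeries.coeff i F| * x ^ i) {δ : ℝ} (hδ : eps0 F < δ)
    {K : Set ℝ} (hK : IsCompact K) (hK1 : ∀ θ ∈ K, Complex.exp (Complex.I * θ) ≠ 1) :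
    ∃ (r₁ c : ℝ) (p : ℕ), 0 < r₁ ∧ 0 < c ∧ (1 - δ) * p < minExp F ∧
      ∀ θ ∈ K, ∀ r : ℝ, 0 < r → r ≤ r₁ →
        ‖evalC F (r * Complex.exp (Complex.I * θ))‖ ≤ evalR F r * Real.exp (-(c * r ^ p)) := by
  have hl := two_le_minExp h1 hgcd
  obtain ⟨y, _, hy0, hyx, hy1, _, Hy⟩ := log_evalC_near_zero h0 (by omega) hx h
  have hf0 : ∀ r : ℝ, 0 < r → r ≤ y → 0 ≤ evalR F r := by
    intro r hr hry
    have := half_le_re_of_norm_sub_one_le (Hy r (by simpa [abs_of_pos hr] using hry)).1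
    rw [evalC_ofReal, Complex.ofReal_re] at this
    linarith
  suffices hsuff : ∃ (r₁ c : ℝ) (p : ℕ), 0 < r₁ ∧ r₁ ≤ y ∧ 0 < c ∧ (1 - δ) * p < minExp F ∧
      ∀ θ ∈ K, ∀ r : ℝ, 0 < r → r ≤ r₁ →
        ‖evalC F (r * Complex.exp (Complex.I * θ))‖ ≤ evalR F r * Real.exp (-(c * r ^ p)) by
    obtain ⟨r₁, c, p, hr, -, hrest⟩ := hsuff
    exact ⟨r₁, c, p, hr, hrest⟩
  refine hK.induction_on (p := fun K => ∃ (r₁ c : ℝ) (p : ℕ), 0 < r₁ ∧ r₁ ≤ y ∧ 0 < c ∧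
      (1 - δ) * p < minExp F ∧ ∀ θ ∈ K, ∀ r : ℝ, 0 < r → r ≤ r₁ →
        ‖evalC F (r * Complex.exp (Complex.I * θ))‖ ≤ evalR F r * Real.exp (-(c * r ^ p)))
    ?_ ?_ ?_ ?_
  · exact ⟨y, 1, 0, hy0, le_rfl, one_pos, by simp; omega, by simp⟩
  · rintro s t hst ⟨r₁, c, p, a1, a2, a3, a4, a5⟩
    exact ⟨r₁, c, p, a1, a2, a3, a4, fun θ hθ => a5 θ (hst hθ)⟩
  · rintro s t ⟨r₁, c, p, a1, a2, a3, a4, a5⟩ ⟨r₁', c', p', b1, b2, b3, b4, b5⟩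
    have hmono : ∀ (d : ℝ) (q : ℕ) (r : ℝ), 0 < r → r ≤ min r₁ r₁' → min c c' ≤ d →
        q ≤ max p p' → evalR F r * Real.exp (-(d * r ^ q)) ≤
          evalR F r * Real.exp (-(min c c' * r ^ max p p')) := by
      intro d q r hr hrr hd hq
      have hry : r ≤ y := (hrr.trans (min_le_left _ _)).trans a2
      refine mul_le_mul_of_nonneg_left (Real.exp_le_exp.2 (neg_le_neg ?_)) (hf0 r hr hry)
      have : r ^ max p p' ≤ r ^ q := pow_le_pow_of_le_one hr.le (hry.trans hy1) hq
      have hc : 0 < min c c' := lt_min a3 b3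
      have hd0 : 0 ≤ d := hc.le.trans hd
      gcongr
    -- For `r ≤ 1` a larger exponent and a smaller constant only weaken the bound.
    refine ⟨min r₁ r₁', min c c', max p p', lt_min a1 b1, (min_le_left _ _).trans a2,
      lt_min a3 b3, ?_, ?_⟩
    · rcases max_choice p p' with hm | hm <;> rw [hm] <;> assumption
    · rintro θ (hθ | hθ) r hr hrr
      · exact (a5 θ hθ r hr (hrr.trans (min_le_left _ _))).trans
          (hmono c p r hr hrr (min_le_left _ _) (le_max_left _ _))
      · exact (b5 θ hθ r hr (hrr.trans (min_le_right _ _))).trans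
          (hmono c' p' r hr hrr (min_le_right _ _) (le_max_right _ _))
  · intro θ₀ hθ₀
    obtain ⟨p, hp, hζp, hinv, hpl⟩ := exists_first_nontrivial h1 hgcd hδ (hK1 θ₀ hθ₀)
    have hone : ‖Complex.exp (Complex.I * θ₀)‖ = 1 := by
      rw [mul_comm]; exact Complex.norm_exp_ofReal_mul_I θ₀
    have hap := coeff_pos_of_first_nontrivial hx h hpos hone hp.2 hζp hinv
    obtain ⟨t₁, r₁, c, ht, hr, hr1, hc, Hb⟩ := norm_evalC_le_near_of_first_nontrivial h0 (by omega)
      ha hx h hp.1 hap hζp hinv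
    refine ⟨Metric.ball θ₀ t₁, nhdsWithin_le_nhds (Metric.ball_mem_nhds _ ht), min r₁ y, c, p,
      lt_min hr hy0, min_le_right _ _, hc, hpl, fun θ hθ r hr hrr => ?_⟩
    exact Hb θ r (by rwa [Metric.mem_ball, Real.dist_eq] at hθ) hr (hrr.trans (min_le_left _ _))

/-- Apply `coeff_pos_of_first_nontrivial` to `ζ = e^{iπ/l}`, for which `ζ^l = -1`. -/
theorem coeff_minExp_pos (h1 : PowerSeries.coeff 1 F = 0)
    (hgcd : ∀ d : ℕ, (∀ i ∈ expSet F, d ∣ i) → d = 1)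
    (hpos : ∀ᶠ r : ℝ in 𝓝[>] 0, StronglyPositiveAt F r) (hx : 0 < x)
    (h : Summable fun i => |PowerSeries.coeff i F| * x ^ i) :
    0 < PowerSeries.coeff (minExp F) F := by
  have hl := two_le_minExp h1 hgcd
  have hl' : ((minExp F : ℕ) : ℂ) ≠ 0 := by exact_mod_cast (by omega : minExp F ≠ 0)
  have hpow : Complex.exp (((Real.pi / minExp F : ℝ) : ℂ) * Complex.I) ^ minExp F = -1 := by
    rw [← Complex.exp_nat_mul, ← Complex.exp_pi_mul_I]
    congr 1
    push_cast
    field_simp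
  refine coeff_pos_of_first_nontrivial (ζ := Complex.exp (((Real.pi / minExp F : ℝ) : ℂ) *
    Complex.I)) hx h hpos (Complex.norm_exp_ofReal_mul_I _) (minExp_mem hgcd).2 ?_ ?_
  · rw [hpow]; norm_num
  · intro i hi hci
    rcases Nat.eq_zero_or_pos i with rfl | hi0
    · simp
    · exact absurd (coeff_eq_zero_of_lt_minExp hi0 hi) hci

end

/-! ### Monotonicity of `μ` and the saddle point. -/

section

variable {F : PowerSeries ℝ} {x : ℝ}

theorem exists_summable_of_lt_radius {r : ℝ} (hr : 0 < r) (h : ENNReal.ofReal r < radius F) :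
    ∃ x, r < x ∧ Summable fun i => |PowerSeries.coeff i F| * x ^ i := by
  obtain ⟨x, hx0, hrx, hxR⟩ := ENNReal.lt_iff_exists_real_btwn.1 h
  exact ⟨x, ((ENNReal.ofReal_lt_ofReal_iff_of_nonneg hr.le).1 hrx),
    summable_norm_coeff_mul_pow hx0 hxR⟩

theorem StronglyPositiveAt.evalR_pos {r : ℝ} (h : StronglyPositiveAt F r) : 0 < evalR F r :=
  (norm_nonneg _).trans_lt (h.norm_lt (ζ := -1) (by simp) (by norm_num))

theorem StronglyPositiveAt.norm_le {w : ℂ} (h : StronglyPositiveAt F ‖w‖) :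
    ‖evalC F w‖ ≤ evalR F ‖w‖ := by
  have hw : (‖w‖ : ℂ) ≠ 0 := Complex.ofReal_ne_zero.2 h.1.ne'
  have e : w = ‖w‖ * (w / ‖w‖) := by field_simp
  by_cases h1 : w / ‖w‖ = 1
  · rw [h1, mul_one] at e
    have h2 : evalC F w = (evalR F ‖w‖ : ℂ) := by
      conv_lhs => rw [e]
      exact evalC_ofReal F _
    rw [h2, Complex.norm_real, Real.norm_of_nonneg h.evalR_pos.le]
  · have hn : ‖w / (‖w‖ : ℂ)‖ = 1 := by
      rw [norm_div, Complex.norm_real, norm_norm, div_self h.1.ne']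
    have := (h.norm_lt hn h1).le
    rwa [← e] at this

/-- Hadamard's three lines theorem for `w ↦ f(e^w)`: by strong positivity the maximum modulus on
each vertical line is attained at the real point. This works on the whole branch, beyond the range
where `σ > 0` is known. -/
theorem convexOn_log_evalR_exp {r : ℝ} (hr : 0 < r)
    (hsp : ∀ s : ℝ, 0 < s → s ≤ r → StronglyPositiveAt F s) :
    ConvexOn ℝ (Set.Iic (Real.log r)) fun t => Real.log (evalR F (Real.exp t)) := by
  obtain ⟨x, hrx, h⟩ := exists_summable_of_lt_radius hr (hsp r hr le_rfl).2.1
  have hexp : ∀ t ≤ Real.log r, Real.exp t ≤ r := fun t ht => by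
    rwa [← Real.le_log_iff_exp_le hr]
  have hspe : ∀ t ≤ Real.log r, StronglyPositiveAt F (Real.exp t) := fun t ht =>
    hsp _ (Real.exp_pos t) (hexp t ht)
  refine LinearOrder.convexOn_of_lt (convex_Iic _) fun a ha b hb hab α β hα hβ hαβ => ?_
  simp only [Set.mem_Iic] at ha hb
  simp only [smul_eq_mul]
  have hle : ∀ w : ℂ, w.re ≤ Real.log r → ‖evalC F (Complex.exp w)‖ ≤ evalR F (Real.exp w.re) := by
    intro w hw
    rw [← Complex.norm_exp]
    refine StronglyPositiveAt.norm_le ?_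
    rw [Complex.norm_exp]
    exact hspe _ hw
  set z : ℂ := ((α * a + β * b : ℝ) : ℂ) with hz
  have hzre : z.re = α * a + β * b := Complex.ofReal_re _
  have hα' : α = 1 - β := by linarith
  have hza : a ≤ z.re := by rw [hzre, hα']; nlinarith
  have hzb : z.re ≤ b := by rw [hzre, hα']; nlinarith
  have key := Complex.HadamardThreeLines.norm_le_interp_of_mem_verticalClosedStrip'
    (f := fun w => evalC F (Complex.exp w)) (z := z) (a := evalR F (Real.exp a))
    (b := evalR F (Real.exp b)) hab ⟨hza, hzb⟩ ?_ ?_ ?_ ?_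
  · have h1 : (z.re - a) / (b - a) = β := by
      rw [hzre, hα', div_eq_iff (by linarith)]; ring
    rw [h1, ← hα'] at key
    have h2 : evalC F (Complex.exp z) = (evalR F (Real.exp (α * a + β * b)) : ℂ) := by
      rw [hz, ← Complex.ofReal_exp, evalC_ofReal]
    have p0 := (hspe _ (hzre ▸ hzb.trans hb)).evalR_pos
    have pa := (hspe _ ha).evalR_pos
    have pb := (hspe _ hb).evalR_pos
    simp only [h2] at key
    rw [Complex.norm_real, Real.norm_of_nonneg p0.le] at key
    have h3 := Real.log_le_log p0 key
    rwa [Real.log_mul (by positivity) (by positivity), Real.log_rpow pa, Real.log_rpow pb] at h3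
  · have hsub : closure (Complex.HadamardThreeLines.verticalStrip a b) ⊆ {w | w.re ≤ b} := by
      refine closure_minimal (fun w hw => ?_) (isClosed_le Complex.continuous_re continuous_const)
      exact hw.2.le
    refine DifferentiableOn.diffContOnCl fun w hw => ?_
    have hwb : w.re ≤ b := hsub hw
    have hn : ‖Complex.exp w‖ < x := by
      rw [Complex.norm_exp]
      exact (hexp _ (hwb.trans hb)).trans_lt hrx
    exact ((differentiableAt_evalC h hn).comp w
      Complex.differentiable_exp.differentiableAt).differentiableWithinAt
  · refine ⟨∑' i, |PowerSeries.coeff i F| * x ^ i, ?_⟩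
    rintro _ ⟨w, hw, rfl⟩
    refine tsum_of_norm_bounded h.hasSum fun i => ?_
    rw [norm_coeff_mul_pow]
    have : ‖Complex.exp w‖ ≤ x := by
      rw [Complex.norm_exp]
      exact (hexp _ (hw.2.trans hb)).trans hrx.le
    gcongr
  · intro w hw
    have hw' : w.re = a := hw
    exact hw' ▸ hle w (by rw [hw']; exact ha)
  · intro w hw
    have hw' : w.re = b := hw
    exact hw' ▸ hle w (by rw [hw']; exact hb)

/-- `μ(r)` is the derivative of the convex function `t ↦ log f(e^t)` at `t = log r`. -/
theorem mu_le_mu {r₁ r₂ : ℝ} (h₁ : 0 < r₁) (h₁₂ : r₁ ≤ r₂)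
    (hsp : ∀ s : ℝ, 0 < s → s ≤ r₂ → StronglyPositiveAt F s) : mu F r₁ ≤ mu F r₂ := by
  rcases h₁₂.eq_or_lt with rfl | hlt
  · exact le_rfl
  have h₂ : 0 < r₂ := h₁.trans hlt
  obtain ⟨x, hrx, h⟩ := exists_summable_of_lt_radius h₂ (hsp r₂ h₂ le_rfl).2.1
  have hconv := convexOn_log_evalR_exp h₂ hsp
  have hder : ∀ r, 0 < r → r ≤ r₂ →
      HasDerivAt (fun t => Real.log (evalR F (Real.exp t))) (mu F r) (Real.log r) := by
    intro r hr hrr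
    have hpos := (hsp r hr hrr).evalR_pos
    have h3 := (hasDerivAt_evalR h (r := r) (by rw [abs_of_pos hr]; linarith)).2
    have h4 := Real.hasDerivAt_exp (Real.log r)
    rw [← Real.exp_log hr] at h3 hpos
    have h5 := (HasDerivAt.comp (h₂ := evalR F) (Real.log r) h3 h4).log hpos.ne'
    refine h5.congr_deriv ?_
    simp only [Function.comp, Real.exp_log hr]
    rw [mu]; ring
  have hlog := Real.log_lt_log h₁ hlt
  exact (hconv.le_slope_of_hasDerivAt hlog.le Set.self_mem_Iic hlog (hder r₁ h₁ hlt.le)).trans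
    (hconv.slope_le_of_hasDerivAt hlog.le Set.self_mem_Iic hlog (hder r₂ h₂ le_rfl))

/-- Confines every saddle to the small interval where the local estimates hold; weak monotonicity is
enough for this. -/
theorem saddle_lt {n k : ℕ} {r R : ℝ} (hn : 0 < n) (hR : 0 < R) (hs : IsSaddle F n k r)
    (hk : (k : ℝ) < n * mu F R) : r < R := by
  by_contra hle
  have h1 := mu_le_mu hR (not_lt.1 hle) hs.2.1
  have hn' : (0 : ℝ) < n := by exact_mod_cast hn
  have := hs.2.2
  nlinarith

theorem existsUnique_saddle {n k : ℕ} {R C : ℝ} (hn : 0 < n) (hk0 : 0 < k) (hR : 0 < R)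
    (hR1 : R ≤ 1) (hl : 0 < minExp F) (hC : 0 < C)
    (hsp : ∀ s : ℝ, 0 < s → s ≤ R → StronglyPositiveAt F s)
    (hmu : ∀ s : ℝ, 0 < s → s ≤ R → mu F s ≤ C * s ^ minExp F)
    (hsig : ∀ s : ℝ, 0 < s → s ≤ R → 0 < sigma F s)
    (hk : (k : ℝ) < n * mu F R) : ∃! r : ℝ, IsSaddle F n k r := by
  have hn' : (0 : ℝ) < n := by exact_mod_cast hn
  have hk' : (0 : ℝ) < k := by exact_mod_cast hk0
  obtain ⟨x, hRx, h⟩ := exists_summable_of_lt_radius hR (hsp R hR le_rfl).2.1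
  have hder : ∀ s, 0 < s → s ≤ R → HasDerivAt (mu F) (deriv (mu F) s) s := fun s hs hsR =>
    (hasDerivAt_mu h (by rw [abs_of_pos hs]; linarith) (hsp s hs hsR).evalR_pos.ne').2
  have hmono : StrictMonoOn (mu F) (Set.Ioc 0 R) := by
    refine strictMonoOn_of_deriv_pos (convex_Ioc 0 R)
      (fun s hs => (hder s hs.1 hs.2).continuousAt.continuousWithinAt) fun s hs => ?_
    rw [interior_Ioc] at hs
    exact pos_of_mul_pos_right (hsig s hs.1 hs.2.le) hs.1.le
  set q := (k : ℝ) / n with hq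
  have hq0 : 0 < q := by positivity
  have hqk : (k : ℝ) = n * q := by rw [hq]; field_simp
  have hqR : q < mu F R := by rw [hq, div_lt_iff₀ hn']; linarith
  -- The second entry gives `μ(s₀) ≤ C s₀ ≤ q/2`, a left endpoint for the intermediate value
  -- theorem.
  set s₀ := min (R / 2) (q / (2 * C)) with hs₀
  have hs₀p : 0 < s₀ := by positivity
  have hs₀R : s₀ < R := (min_le_left _ _).trans_lt (by linarith)
  have hs₀q : mu F s₀ < q := by
    refine (hmu s₀ hs₀p hs₀R.le).trans_lt ?_
    have h1 : s₀ ^ minExp F ≤ s₀ := pow_le_of_le_one hs₀p.le (by linarith) hl.ne'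
    have h2 : s₀ ≤ q / (2 * C) := min_le_right _ _
    rw [le_div_iff₀ (by positivity)] at h2
    nlinarith
  obtain ⟨r, hr, hrq⟩ := intermediate_value_Icc hs₀R.le
    (fun s hs => (hder s (hs₀p.trans_le hs.1) hs.2).continuousAt.continuousWithinAt)
    (⟨hs₀q.le, hqR.le⟩ : q ∈ Set.Icc (mu F s₀) (mu F R))
  have hr0 : 0 < r := hs₀p.trans_le hr.1
  refine ⟨r, ⟨hr0, fun s hs hsr => hsp s hs (hsr.trans hr.2), by rw [hrq, hqk]⟩, fun r' hr' => ?_⟩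
  have hr'R := saddle_lt hn hR hr' hk
  refine hmono.injOn ⟨hr'.1, hr'R.le⟩ ⟨hr0, hr.2⟩ ?_
  have := hr'.2.2
  rw [hqk] at this
  rw [hrq]
  exact (mul_left_cancel₀ hn'.ne' this).symm

theorem exp_I_mul_ne_one {θ : ℝ} (h0 : θ ≠ 0) (hθ : |θ| ≤ Real.pi) :
    Complex.exp (Complex.I * θ) ≠ 1 := by
  intro h
  obtain ⟨m, hm⟩ := Complex.exp_eq_one_iff.1 h
  have h1 : (θ : ℂ) = ((m * (2 * Real.pi) : ℝ) : ℂ) := by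
    apply mul_left_cancel₀ Complex.I_ne_zero
    rw [hm]; push_cast; ring
  have h2 : θ = m * (2 * Real.pi) := by exact_mod_cast h1
  have hpi := Real.pi_pos
  rcases eq_or_ne m 0 with rfl | hm0
  · simp at h2; exact h0 h2
  · have h3 : (1 : ℝ) ≤ |(m : ℝ)| := by exact_mod_cast Int.one_le_abs hm0
    rw [h2, abs_mul, abs_of_pos (by positivity : 0 < 2 * Real.pi)] at hθ
    nlinarith

/-- Substituting `n = k/μ` turns powers of `nσ` into powers of `k`, and so produces the factor
`μ^ν/σ^ν` of `c_ν`. -/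
theorem expansion_sum_eq {n k : ℕ} {r : ℝ} (hk : (k : ℝ) = n * mu F r) (hk0 : 0 < k)
    (hphi0 : phi F r 0 = 1) (N : ℕ) :
    ∑ ν ∈ Finset.range (N + 1), (-1 : ℂ) ^ ν / ((2 * ((n * sigma F r : ℝ) : ℂ)) ^ ν *
        ν.factorial) * iteratedDeriv (2 * ν) (fun z => phi F r z ^ (-(ν : ℂ) - 1 / 2)) 0 =
      1 + ∑ ν ∈ Finset.Icc 1 N, expansionCoeff F r ν / (k : ℂ) ^ ν := by
  have hkc : (k : ℂ) = n * mu F r := by exact_mod_cast hk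
  have hkc0 : (k : ℂ) ≠ 0 := by exact_mod_cast hk0.ne'
  have hn0 : (n : ℂ) ≠ 0 := fun h => hkc0 (by rw [hkc, h, zero_mul])
  have hm0 : (mu F r : ℂ) ≠ 0 := fun h => hkc0 (by rw [hkc, h, mul_zero])
  rw [Finset.range_eq_Ico, Finset.sum_eq_sum_Ico_succ_bot (Nat.succ_pos N)]
  congr 1
  · simp [hphi0]
  · refine Finset.sum_congr (by ext; simp) fun ν _ => ?_
    rw [expansionCoeff, hkc, mul_pow, mul_pow, mul_pow]
    push_cast
    rw [mul_pow]
    field_simp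

end

/-! ### Central arc, remaining arcs and asymptotic bookkeeping. -/

section

variable {F : PowerSeries ℝ}

theorem summable_of_le {x r : ℝ} (hr : 0 ≤ r) (hrx : r ≤ x)
    (h : Summable fun i => |PowerSeries.coeff i F| * x ^ i) :
    Summable fun i => |PowerSeries.coeff i F| * r ^ i :=
  Summable.of_nonneg_of_le (fun i => by positivity) (fun i => by gcongr) h

/-- Cauchy's integral is split at `|θ| = ρ/2`. The central arc is exactly the Laplace integral with
`t = nσ`; the two outer arcs are bounded by the supremum `B ^ n`. -/
theorem norm_coeff_sub_mainTerm_le {ρ r C B : ℝ} {N n k : ℕ} (hρ : 0 < ρ) (hρ1 : ρ ≤ 1)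
    (hlap : ‖(√(n * sigma F r / (2 * Real.pi)) : ℝ) * (∫ θ in (-(ρ / 2))..(ρ / 2),
          Complex.exp (-((n * sigma F r * θ ^ 2 / 2 : ℝ) : ℂ) * phi F r (Complex.I * θ))) -
        ∑ ν ∈ Finset.range (N + 1), (-1 : ℂ) ^ ν / ((2 * ((n * sigma F r : ℝ) : ℂ)) ^ ν *
          ν.factorial) * iteratedDeriv (2 * ν) (fun z => phi F r z ^ (-(ν : ℂ) - 1 / 2)) 0‖ ≤ C)
    (hr : 0 < r) (h : Summable fun i => |PowerSeries.coeff i F| * r ^ i) (hf : 0 < evalR F r)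
    (hσ : 0 < sigma F r) (hk : (k : ℝ) = n * mu F r) (hk0 : 0 < k)
    (hexp : ∀ z ∈ Metric.ball (0 : ℂ) (2 * ρ), evalC F ((r : ℂ) * Complex.exp z) =
          evalR F r * Complex.exp (mu F r * z + 1 / 2 * sigma F r * z ^ 2 * phi F r z))
    (hoff : ∀ θ : ℝ, ρ / 2 ≤ |θ| → |θ| ≤ Real.pi →
      ‖evalC F (r * Complex.exp (Complex.I * θ))‖ ≤ evalR F r * B) :
    ‖((PowerSeries.coeff k (F ^ n) : ℝ) : ℂ) - (mainTerm F n k r : ℂ) *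
        (1 + ∑ ν ∈ Finset.Icc 1 N, expansionCoeff F r ν / (k : ℂ) ^ ν)‖ ≤
      mainTerm F n k r * (C + √(2 * Real.pi * (n * sigma F r)) * B ^ n) := by
  have hπ := Real.pi_gt_three
  have hn0 : 0 < n := Nat.pos_of_ne_zero fun h0 => by
    rw [h0] at hk; simp at hk; omega
  have hn' : (0 : ℝ) < n := by exact_mod_cast hn0
  set lam := n * sigma F r with hlam
  have hlam0 : 0 < lam := by positivity
  set f := evalR F r with hfdef
  have hfc : (f : ℂ) ≠ 0 := Complex.ofReal_ne_zero.2 hf.ne'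
  rw [expansion_sum_eq hk hk0 (by simp [phi])] at hlap
  set Ser := 1 + ∑ ν ∈ Finset.Icc 1 N, expansionCoeff F r ν / (k : ℂ) ^ ν
  have hone : ∀ θ : ℝ, ‖(r : ℂ) * Complex.exp (Complex.I * θ)‖ = r := by
    intro θ
    rw [norm_mul, mul_comm Complex.I, Complex.norm_exp_ofReal_mul_I]; simp [hr.le]
  have hpow := evalC_pow hr.le h n
  set q : ℝ → ℂ := fun θ => (evalC F (r * Complex.exp (Complex.I * θ)) / f) ^ n *
    Complex.exp (-(k : ℂ) * (Complex.I * (θ : ℂ))) with hq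
  have hcoef : ((PowerSeries.coeff k (F ^ n) : ℝ) : ℂ) * (2 * Real.pi * r ^ k) =
      f ^ n * ∫ θ in (-Real.pi)..Real.pi, q θ := by
    have := coeff_eq_integral hr hpow.1 k
    rw [mul_comm ((PowerSeries.coeff k (F ^ n) : ℝ) : ℂ), mul_right_comm, ← this,
      ← intervalIntegral.integral_const_mul]
    refine intervalIntegral.integral_congr fun θ _ => ?_
    simp only [hq]
    rw [hpow.2 _ (hone θ).le, div_pow]
    field_simp
  have hqc : Continuous q := by
    refine Continuous.mul (Continuous.pow (Continuous.div_const ?_ _) _) (by fun_prop)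
    have hco : ContinuousOn (evalC F) (Metric.closedBall 0 r) := by
      refine continuousOn_tsum (fun i => by fun_prop) h fun i w hw => ?_
      rw [norm_coeff_mul_pow]
      have : ‖w‖ ≤ r := mem_closedBall_zero_iff.1 hw
      gcongr
    exact hco.comp_continuous (by fun_prop) fun θ => mem_closedBall_zero_iff.2 (hone θ).le
  have hqi : ∀ a b : ℝ, IntervalIntegrable q MeasureTheory.volume a b := fun a b =>
    hqc.intervalIntegrable a b
  have hmid : ∫ θ in (-(ρ / 2))..(ρ / 2), q θ = ∫ θ in (-(ρ / 2))..(ρ / 2),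
      Complex.exp (-((lam * θ ^ 2 / 2 : ℝ) : ℂ) * phi F r (Complex.I * θ)) := by
    refine intervalIntegral.integral_congr fun θ hθ => ?_
    rw [Set.uIcc_of_le (by linarith)] at hθ
    have hb : Complex.I * (θ : ℂ) ∈ Metric.ball (0 : ℂ) (2 * ρ) := by
      rw [mem_ball_zero_iff, norm_mul, Complex.norm_I, one_mul, Complex.norm_real,
        Real.norm_eq_abs, abs_lt]
      constructor <;> linarith [hθ.1, hθ.2]
    simp only [hq]
    rw [hexp _ hb, mul_div_cancel_left₀ _ hfc, ← Complex.exp_nat_mul, ← Complex.exp_add]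
    congr 1
    -- The saddle equation cancels `inμθ` against `-ikθ`.
    have hkc : (k : ℂ) = n * mu F r := by exact_mod_cast hk
    rw [hkc, hlam, mul_pow, Complex.I_sq]
    push_cast; ring
  have hB0 : 0 ≤ B := by
    have h1 := (norm_nonneg _).trans (hoff Real.pi (by rw [abs_of_pos] <;> linarith)
      (by rw [abs_of_pos]; linarith))
    exact nonneg_of_mul_nonneg_right h1 hf
  have hqb : ∀ θ : ℝ, ρ / 2 ≤ |θ| → |θ| ≤ Real.pi → ‖q θ‖ ≤ B ^ n := by
    intro θ h1 h2
    simp only [hq]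
    have h3 : ‖Complex.exp (-(k : ℂ) * (Complex.I * (θ : ℂ)))‖ = 1 := by
      rw [show -(k : ℂ) * (Complex.I * (θ : ℂ)) = ((-(k * θ) : ℝ) : ℂ) * Complex.I by
        push_cast; ring, Complex.norm_exp_ofReal_mul_I]
    rw [norm_mul, h3, mul_one, norm_pow, norm_div, Complex.norm_real, Real.norm_of_nonneg hf.le]
    gcongr
    rw [div_le_iff₀ hf, mul_comm B]
    exact hoff θ h1 h2
  have hleft : ‖∫ θ in (-Real.pi)..(-(ρ / 2)), q θ‖ ≤ B ^ n * Real.pi := by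
    refine (intervalIntegral.norm_integral_le_of_norm_le_const (C := B ^ n) fun θ hθ => ?_).trans ?_
    · rw [Set.uIoc_of_le (by linarith)] at hθ
      have hθ0 : |θ| = -θ := abs_of_nonpos (by linarith [hθ.2])
      exact hqb θ (by rw [hθ0]; linarith [hθ.2]) (by rw [hθ0]; linarith [hθ.1])
    · rw [abs_of_nonneg (by linarith)]
      gcongr; linarith
  have hright : ‖∫ θ in (ρ / 2)..Real.pi, q θ‖ ≤ B ^ n * Real.pi := by
    refine (intervalIntegral.norm_integral_le_of_norm_le_const (C := B ^ n) fun θ hθ => ?_).trans ?_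
    · rw [Set.uIoc_of_le (by linarith)] at hθ
      have hθ0 : |θ| = θ := abs_of_nonneg (by linarith [hθ.1])
      exact hqb θ (by rw [hθ0]; linarith [hθ.1]) (by rw [hθ0]; linarith [hθ.2])
    · rw [abs_of_nonneg (by linarith)]
      gcongr; linarith
  set s := √(lam / (2 * Real.pi)) with hs
  have hs0 : 0 < s := Real.sqrt_pos.2 (by positivity)
  have hs2 : s * (2 * Real.pi) = √(2 * Real.pi * lam) := by
    have h1 : (s * (2 * Real.pi)) ^ 2 = 2 * Real.pi * lam := by
      rw [mul_pow, hs, Real.sq_sqrt (by positivity)]; field_simp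
    rw [← h1, Real.sqrt_sq (by positivity)]
  have hmain : ((PowerSeries.coeff k (F ^ n) : ℝ) : ℂ) = (mainTerm F n k r : ℂ) *
      (s * ∫ θ in (-Real.pi)..Real.pi, q θ) := by
    have hsq : √(2 * Real.pi * n * sigma F r) = s * (2 * Real.pi) := by
      rw [hs2, hlam]; congr 1; ring
    have hsc : (s : ℂ) ≠ 0 := Complex.ofReal_ne_zero.2 hs0.ne'
    have hrc : (r : ℂ) ≠ 0 := Complex.ofReal_ne_zero.2 hr.ne'
    have hpc : (Real.pi : ℂ) ≠ 0 := Complex.ofReal_ne_zero.2 Real.pi_ne_zero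
    rw [mainTerm, hsq, ← hfdef]
    push_cast
    have h1 : (2 * Real.pi * r ^ k : ℂ) ≠ 0 :=
      mul_ne_zero (mul_ne_zero two_ne_zero hpc) (pow_ne_zero _ hrc)
    rw [eq_div_of_mul_eq h1 hcoef]
    field_simp
  have hmpos : 0 < mainTerm F n k r := by
    rw [mainTerm]; positivity
  have hsplit : ∫ θ in (-Real.pi)..Real.pi, q θ = (∫ θ in (-Real.pi)..(-(ρ / 2)), q θ) +
      (∫ θ in (-(ρ / 2))..(ρ / 2), q θ) + ∫ θ in (ρ / 2)..Real.pi, q θ := by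
    rw [intervalIntegral.integral_add_adjacent_intervals (hqi _ _) (hqi _ _),
      intervalIntegral.integral_add_adjacent_intervals (hqi _ _) (hqi _ _)]
  rw [hmain, ← mul_sub, norm_mul, Complex.norm_real, Real.norm_of_nonneg hmpos.le]
  refine mul_le_mul_of_nonneg_left ?_ hmpos.le
  rw [hsplit, hmid]
  rw [← hmid] at hlap ⊢
  set I₁ := ∫ θ in (-Real.pi)..(-(ρ / 2)), q θ
  set I₂ := ∫ θ in (-(ρ / 2))..(ρ / 2), q θ
  set I₃ := ∫ θ in (ρ / 2)..Real.pi, q θ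
  calc ‖(s : ℂ) * (I₁ + I₂ + I₃) - Ser‖ = ‖((s : ℂ) * I₂ - Ser) + (s * I₁ + s * I₃)‖ := by
        congr 1; ring
    _ ≤ C + (s * (B ^ n * Real.pi) + s * (B ^ n * Real.pi)) := by
        refine (norm_add_le _ _).trans (add_le_add hlap ((norm_add_le _ _).trans ?_))
        rw [norm_mul, norm_mul, Complex.norm_real, Real.norm_of_nonneg hs0.le]
        gcongr
    _ = C + √(2 * Real.pi * lam) * B ^ n := by rw [← hs2]; ring

theorem eventually_rpow_mul_exp_le {b η A : ℝ} (hb : 0 < b) (hη : 0 < η) (M : ℝ) (hA : 0 < A) :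
    ∀ᶠ n : ℕ in atTop, (n : ℝ) ^ M * Real.exp (-(b * (n : ℝ) ^ η)) ≤ A := by
  have h1 := tendsto_rpow_mul_exp_neg_mul_atTop_nhds_zero (M / η) b hb
  have h2 : Tendsto (fun n : ℕ => (n : ℝ) ^ η) atTop atTop :=
    (tendsto_rpow_atTop hη).comp tendsto_natCast_atTop_atTop
  filter_upwards [(h1.comp h2).eventually_le_const hA] with n hn
  simp only [Function.comp] at hn
  rwa [← Real.rpow_mul n.cast_nonneg, mul_div_cancel₀ _ hη.ne', neg_mul] at hn

theorem isTheta_bounds {k : ℕ → ℕ} {δ : ℝ}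
    (hk : (fun n : ℕ => (k n : ℝ)) =Θ[atTop] fun n : ℕ => (n : ℝ) ^ δ) :
    ∃ A₁ A₂ : ℝ, 0 < A₁ ∧ 0 < A₂ ∧
      ∀ᶠ n : ℕ in atTop, A₁ * (n : ℝ) ^ δ ≤ k n ∧ (k n : ℝ) ≤ A₂ * (n : ℝ) ^ δ := by
  obtain ⟨A₂, hA₂, h2⟩ := hk.1.exists_pos
  obtain ⟨A₁, hA₁, h1⟩ := hk.2.exists_pos
  refine ⟨A₁⁻¹, A₂, inv_pos.2 hA₁, hA₂, ?_⟩
  filter_upwards [h1.bound, h2.bound] with n b1 b2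
  rw [Real.norm_of_nonneg (by positivity), Real.norm_of_nonneg (by positivity)] at b1 b2
  refine ⟨?_, b2⟩
  rw [inv_mul_le_iff₀ hA₁]
  exact b1

theorem eventually_lt_mul {k : ℕ → ℕ} {δ A m : ℝ} (hδ : δ < 1) (hm : 0 < m)
    (hk : ∀ᶠ n : ℕ in atTop, (k n : ℝ) ≤ A * (n : ℝ) ^ δ) :
    ∀ᶠ n : ℕ in atTop, (k n : ℝ) < n * m := by
  have h1 : Tendsto (fun n : ℕ => A * (n : ℝ) ^ (-(1 - δ))) atTop (𝓝 (A * 0)) :=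
    ((tendsto_rpow_neg_atTop (by linarith)).comp tendsto_natCast_atTop_atTop).const_mul A
  rw [mul_zero] at h1
  filter_upwards [hk, h1.eventually_lt_const hm, eventually_gt_atTop 0] with n b1 b2 hn
  have hn' : (0 : ℝ) < n := by exact_mod_cast hn
  refine b1.trans_lt ?_
  have e : (n : ℝ) ^ δ = n * (n : ℝ) ^ (-(1 - δ)) := by
    rw [neg_sub, Real.rpow_sub_one hn'.ne']; field_simp
  rw [e]
  nlinarith

/-- The off-saddle contribution is smaller than every power of `k`. -/
theorem eventually_tail_le {k : ℕ → ℕ} {δ A₁ A₂ C c : ℝ} {l p : ℕ} (hl : 0 < l) (hA₁ : 0 < A₁)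
    (hA₂ : 0 < A₂) (hC : 0 < C) (hc : 0 < c) (hδ : δ < 1) (hp : (1 - δ) * p < l)
    (hk : ∀ᶠ n : ℕ in atTop, A₁ * (n : ℝ) ^ δ ≤ k n ∧ (k n : ℝ) ≤ A₂ * (n : ℝ) ^ δ) (N : ℕ) :
    ∀ᶠ n : ℕ in atTop, ∀ r s : ℝ, 0 < r → r ≤ 1 → (k n : ℝ) ≤ n * (C * r ^ l) →
      s ≤ C * r ^ l → √(2 * Real.pi * (n * s)) * Real.exp (-(c * r ^ p)) ^ n ≤
        1 / (k n : ℝ) ^ (N + 1) := by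
  have hl' : (0 : ℝ) < l := by exact_mod_cast hl
  -- From `r^l ≳ n^(δ-1)` it follows that `n r^p ≳ n^η`, and `η > 0` is precisely the condition on
  -- `p`.
  set η := 1 - (1 - δ) * p / l with hη
  have hη0 : 0 < η := by
    rw [hη, sub_pos, div_lt_one hl']; exact hp
  set b := c * (A₁ / C) ^ ((p : ℝ) / l) with hb
  have hb0 : 0 < b := by positivity
  -- The square root costs one power of `n` and `k^(N+1)` costs `N + 1` more; `G` gathers their
  -- constants.
  set G := (2 * Real.pi * C + 1) * A₂ ^ (N + 1) with hG
  have hG0 : 0 < G := by positivity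
  filter_upwards [hk, eventually_gt_atTop 0,
    eventually_rpow_mul_exp_le hb0 hη0 ((N + 2 : ℕ) : ℝ) (A := 1 / G) (by positivity)]
    with n ⟨hk1, hk2⟩ hn hexp r s hr hr1 hkr hs
  have hn' : (0 : ℝ) < n := by exact_mod_cast hn
  have hn1 : (1 : ℝ) ≤ n := by exact_mod_cast hn
  have hk0 : (0 : ℝ) < k n := lt_of_lt_of_le (by positivity) hk1
  -- lower bound for `r ^ l`
  have hrl : A₁ / C * (n : ℝ) ^ (δ - 1) ≤ r ^ l := by
    rw [Real.rpow_sub_one hn'.ne']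
    have := hk1.trans hkr
    rw [div_mul_div_comm, div_le_iff₀ (by positivity)]
    linarith
  have hrp : (A₁ / C) ^ ((p : ℝ) / l) * (n : ℝ) ^ (η - 1) ≤ r ^ p := by
    have h1 : r ^ p = (r ^ l) ^ ((p : ℝ) / l) := by
      rw [← Real.rpow_natCast r l, ← Real.rpow_mul hr.le, mul_div_cancel₀ _ hl'.ne',
        Real.rpow_natCast]
    have h2 : (n : ℝ) ^ (η - 1) = ((n : ℝ) ^ (δ - 1)) ^ ((p : ℝ) / l) := by
      rw [← Real.rpow_mul hn'.le, hη]; congr 1; field_simp; ring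
    rw [h1, h2, ← Real.mul_rpow (by positivity) (by positivity)]
    exact Real.rpow_le_rpow (by positivity) hrl (by positivity)
  have hE : Real.exp (-(c * r ^ p)) ^ n ≤ Real.exp (-(b * (n : ℝ) ^ η)) := by
    rw [← Real.exp_nat_mul]
    apply Real.exp_le_exp.2
    have h1 : b * (n : ℝ) ^ η = n * (c * ((A₁ / C) ^ ((p : ℝ) / l) * (n : ℝ) ^ (η - 1))) := by
      rw [Real.rpow_sub_one hn'.ne', hb]; field_simp
    rw [h1, mul_neg]
    apply neg_le_neg
    gcongr
  have hsq : √(2 * Real.pi * (n * s)) ≤ (2 * Real.pi * C + 1) * n := by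
    rw [Real.sqrt_le_left (by positivity)]
    have h1 : r ^ l ≤ 1 := pow_le_one₀ hr.le hr1
    have h2 : s ≤ C := hs.trans (mul_le_of_le_one_right hC.le h1)
    have hπ := Real.pi_pos
    set P := 2 * Real.pi * C with hP
    have hP0 : 0 < P := by positivity
    calc 2 * Real.pi * (n * s) ≤ 2 * Real.pi * (n * C) := by gcongr
      _ = P * n := by rw [hP]; ring
      _ ≤ (P + 1) ^ 2 * (n * n) := by
        have : P ≤ (P + 1) ^ 2 := by nlinarith
        have h3 : (n : ℝ) ≤ n * n := by nlinarith
        gcongr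
      _ = _ := by ring
  have hkN : (k n : ℝ) ^ (N + 1) ≤ A₂ ^ (N + 1) * (n : ℝ) ^ (N + 1) := by
    rw [← mul_pow]
    have h1 : (n : ℝ) ^ δ ≤ n := by
      calc (n : ℝ) ^ δ ≤ (n : ℝ) ^ (1 : ℝ) := Real.rpow_le_rpow_of_exponent_le hn1 hδ.le
        _ = n := Real.rpow_one _
    gcongr
    exact hk2.trans (by gcongr)
  rw [le_div_iff₀ (by positivity)]
  rw [Real.rpow_natCast, le_div_iff₀ hG0] at hexp
  calc _ ≤ ((2 * Real.pi * C + 1) * n) * Real.exp (-(b * (n : ℝ) ^ η)) *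
        (A₂ ^ (N + 1) * (n : ℝ) ^ (N + 1)) := by gcongr
    _ = (n : ℝ) ^ (N + 2) * Real.exp (-(b * (n : ℝ) ^ η)) * G := by rw [hG]; ring
    _ ≤ 1 := hexp

end

end LargePowers

end

/-! ### The main theorem. -/

theorem theorem0 (F : PowerSeries ℝ)
    (h0 : PowerSeries.coeff 0 F = 1)
    (h1 : PowerSeries.coeff 1 F = 0)
    (hgcd : ∀ d : ℕ, (∀ i ∈ LargePowers.expSet F, d ∣ i) → d = 1)
    (hpos : ∀ᶠ r : ℝ in 𝓝[>] 0, LargePowers.StronglyPositiveAt F r)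
    (δ : ℝ) (hδ₀ : LargePowers.eps0 F < δ) (hδ₁ : δ < 1)
    (k : ℕ → ℕ)
    (hk : (fun n : ℕ => (k n : ℝ)) =Θ[atTop] fun n : ℕ => (n : ℝ) ^ δ) :
    (∀ᶠ n : ℕ in atTop, ∃! r : ℝ, LargePowers.IsSaddle F n (k n) r) ∧
    ∀ r : ℕ → ℝ, (∀ᶠ n : ℕ in atTop, LargePowers.IsSaddle F n (k n) (r n)) →
      ∀ N : ℕ,
        (fun n : ℕ =>
            ((PowerSeries.coeff (k n) (F ^ n) : ℝ) : ℂ) -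
              (LargePowers.mainTerm F n (k n) (r n) : ℂ) *
                (1 + ∑ ν ∈ Finset.Icc 1 N,
                  LargePowers.expansionCoeff F (r n) ν / (k n : ℂ) ^ ν))
          =O[atTop]
        fun n : ℕ => LargePowers.mainTerm F n (k n) (r n) / (k n : ℝ) ^ (N + 1) := by
  open LargePowers in
  have hl2 := two_le_minExp h1 hgcd
  have hl : 0 < minExp F := by omega
  obtain ⟨y, hy, hspy⟩ := mem_nhdsGT_iff_exists_Ioo_subset.1 hpos
  have hy0 : (0 : ℝ) < y := hy
  obtain ⟨x, hyx, h⟩ := exists_summable_of_lt_radius (half_pos hy0)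
    (hspy ⟨half_pos hy0, half_lt_self hy0⟩ : StronglyPositiveAt F (y / 2)).2.1
  have hx : 0 < x := (half_pos hy0).trans hyx
  have ha := coeff_minExp_pos h1 hgcd hpos hx h
  obtain ⟨r₀, ρ, c, C, hr₀, hr₀x, hr₀1, hρ, hρ1, hc, hC, Hloc⟩ := local_expansion h0 hl ha hx h
  have hK : IsCompact (Set.Icc (-Real.pi) (-(ρ / 2)) ∪ Set.Icc (ρ / 2) Real.pi) :=
    isCompact_Icc.union isCompact_Icc
  obtain ⟨r₁, c₁, p, hr₁, hc₁, hp, Hoff⟩ := norm_evalC_le_off_saddle h0 h1 hgcd hpos ha hx h hδ₀ hK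
    (by
      have hπ := Real.pi_pos
      rintro θ (hθ | hθ)
      · exact exp_I_mul_ne_one (by linarith [hθ.2]) (by
          rw [abs_of_nonpos (by linarith [hθ.2])]; linarith [hθ.1])
      · exact exp_I_mul_ne_one (by linarith [hθ.1]) (by
          rw [abs_of_nonneg (by linarith [hθ.1])]; exact hθ.2))
  set R := min (y / 2) (min r₀ r₁) with hR
  have hR0 : 0 < R := by positivity
  have hRy : R ≤ y / 2 := min_le_left _ _
  have hRr₀ : R ≤ r₀ := (min_le_right _ _).trans (min_le_left _ _)
  have hRr₁ : R ≤ r₁ := (min_le_right _ _).trans (min_le_right _ _)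
  have hspR : ∀ s : ℝ, 0 < s → s ≤ R → StronglyPositiveAt F s := fun s hs hsR =>
    hspy ⟨hs, by linarith⟩
  have hmuR : 0 < mu F R := lt_of_lt_of_le (by positivity) (Hloc R hR0 hRr₀).2.1
  obtain ⟨A₁, A₂, hA₁, hA₂, hkA⟩ := isTheta_bounds hk
  have hklt := eventually_lt_mul hδ₁ hmuR (hkA.mono fun n h => h.2)
  have hkpos : ∀ᶠ n : ℕ in atTop, 0 < k n := by
    filter_upwards [hkA, eventually_gt_atTop 0] with n h hn
    have hn' : (0 : ℝ) < n := by exact_mod_cast hn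
    exact_mod_cast lt_of_lt_of_le (by positivity : 0 < A₁ * (n : ℝ) ^ δ) h.1
  refine ⟨?_, fun r hr N => ?_⟩
  · filter_upwards [hklt, hkpos, eventually_gt_atTop 0] with n h1 h2 hn
    exact existsUnique_saddle hn h2 hR0 (hRr₀.trans hr₀1) hl hC hspR
      (fun s hs hsR => (Hloc s hs (hsR.trans hRr₀)).2.2.1)
      (fun s hs hsR => lt_of_lt_of_le (by positivity) (Hloc s hs (hsR.trans hRr₀)).2.2.2.1) h1
  · obtain ⟨C₀, hC₀, Hlap⟩ := laplace_expansion hρ N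
    have htail := eventually_tail_le (N := N) hl hA₁ hA₂ hC hc₁ hδ₁ hp hkA
    -- The first summand is the Laplace error rewritten in `k`; the 1 is the tail.
    refine IsBigO.of_bound (C₀ * (C / c) ^ (N + 1) + 1) ?_
    filter_upwards [hr, hklt, hkpos, eventually_gt_atTop 0, htail] with n hs hkn hk0 hn htl
    have hn' : (0 : ℝ) < n := by exact_mod_cast hn
    have hk0' : (0 : ℝ) < k n := by exact_mod_cast hk0
    have hrR : r n ≤ R := (saddle_lt hn hR0 hs hkn).le
    have hr0 : 0 < r n := hs.1
    obtain ⟨hf, -, hμ2, hσ1, hσ2, hφd, hφre, hexp⟩ := Hloc (r n) hr0 (hrR.trans hRr₀)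
    have hσ0 : 0 < sigma F (r n) := lt_of_lt_of_le (by positivity) hσ1
    have hmain : 0 < mainTerm F n (k n) (r n) := by
      rw [mainTerm]
      have : 0 < evalR F (r n) := by linarith
      positivity
    have hbound := norm_coeff_sub_mainTerm_le (N := N) hρ hρ1
      (Hlap _ hφd hφre (n * sigma F (r n)) (by positivity)) hr0
      (summable_of_le hr0.le (by linarith) h) (by linarith) hσ0 hs.2.2 hk0 hexp
      (B := Real.exp (-(c₁ * r n ^ p))) (fun θ hθ1 hθ2 => by
        refine Hoff θ ?_ (r n) hr0 (hrR.trans hRr₁)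
        rcases le_total 0 θ with hθ | hθ
        · rw [abs_of_nonneg hθ] at hθ1 hθ2
          exact Or.inr ⟨hθ1, hθ2⟩
        · rw [abs_of_nonpos hθ] at hθ1 hθ2
          exact Or.inl ⟨by linarith, by linarith⟩)
    refine hbound.trans ?_
    have hkr : (k n : ℝ) ≤ n * (C * r n ^ minExp F) := by
      rw [hs.2.2]; gcongr
    have ht := htl (r n) (sigma F (r n)) hr0 (by linarith) hkr hσ2
    -- Both `μ` and `σ` have order `r^l`, so `nσ` is at least a fixed multiple of `k = nμ`.
    have hlam : (k n : ℝ) * (c / C) ≤ n * sigma F (r n) := by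
      rw [mul_div_assoc', div_le_iff₀ hC]
      calc (k n : ℝ) * c ≤ n * (C * r n ^ minExp F) * c := by gcongr
        _ = n * (c * r n ^ minExp F) * C := by ring
        _ ≤ n * sigma F (r n) * C := by gcongr
    have hmid : C₀ / (n * sigma F (r n)) ^ (N + 1) ≤
        C₀ * (C / c) ^ (N + 1) / (k n : ℝ) ^ (N + 1) := by
      calc C₀ / (n * sigma F (r n)) ^ (N + 1) ≤ C₀ / ((k n : ℝ) * (c / C)) ^ (N + 1) := by gcongr
        _ = _ := by rw [mul_pow, div_pow, div_pow]; field_simp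
    rw [Real.norm_of_nonneg (by positivity)]
    calc _ ≤ mainTerm F n (k n) (r n) * (C₀ * (C / c) ^ (N + 1) / (k n : ℝ) ^ (N + 1) +
          1 / (k n : ℝ) ^ (N + 1)) := by gcongr
      _ = _ := by ring
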